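/- **Setting.** Let $k,d\ge 1$ be integers, $\lambda=d/k$, and for $\ell\in\mathbb N$ let $n=k\ell$ and $m=d\ell=\lambda n$ be the numbers of variables and of clauses; limits $n\to\infty$ are taken with $k,d$ fixed. An instance is $X=(B,v)\in\mathbb F_2^{m\times n}\times\mathbb F_2^m$, and $g_X(z)=m-\lVert Bz\oplus v\rVert_1$ is the number of clauses satisfied by $z\in\mathbb F_2^n$. The variables are split into $k$ blocks (layers) of size $\ell$. The transposed Gallager ensemble $\mathbb P_1$ is the law of $(B,v)$, where $v$ is uniform on $\mathbb F_2^m$ and, independently, $B^{\intercal}$ is the parity check matrix obtained by stacking $k$ independent layers, each a uniformly random bipartite graph between the $m$ clauses (of degree $1$) and the $\ell$ variables of the block (of degree $d$). For $\kappa\in[0,1]$, the $(\kappa,R)$-correlated ensemble $\mathbb P^{(\kappa)}_R$ is the law of $\big((B,v^{(r)})\big)_{r=1}^R$, where $(B,v^{(1)})\sim\mathbb P_1$, a uniformly random order of the clauses is drawn independently, and for $r\ge2$ the vector $v^{(r)}$ arises from $v^{(1)}$ by replacing the parities of the first $\lfloor\kappa m\rfloor$ clauses in this order (the same order for all $r$)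 by independent fair bits. **OGP and chaos.** For $z,z'\in\mathbb F_2^n$ put $d_k(z,z')=\sum_{i=1}^k\min(w_i,\ell-w_i)$, with $w_i$ the Hamming distance of $z$ and $z'$ on block $i$. For instances $X^{(1)},\dots,X^{(R)}$ let $\mathcal S^{(R,\mu,\nu_1,\nu_2)}$ be the set of $(z^{(1)},\dots,z^{(R)})\in(\mathbb F_2^n)^R$ with $g_{X^{(r)}}(z^{(r)})\ge\mu\lambda n$ for all $r$ and $d_k(z^{(r)},z^{(r')})\in[\nu_1n,\nu_2n]$ for all $r\ne r'$. The *chaos property* with parameters $(R,\mu,\nu_2)$, $R\ge2$, $0<\nu_2<1/2$, holds if for every $\mu'\ge\mu$, $\Pr_{\mathbb P_R^{(1)}}[\mathcal S^{(R,\mu',0,\nu_2)}\neq\varnothing]\le e^{-\Omega(n)}$. The *$R$-OGP* with parameters $(R,\mu,\nu_1,\nu_2)$, $R\ge 2$, $0\le\nu_1<\nu_2<1/2$, holds if for every $\kappa\in[0,1]$ and every $\mu'\ge\mu$, $\Pr_{\mathbb P_R^{(\kappa)}}[\mathcal S^{(R,\mu',\nu_1,\nu_2)}\neq\varnothing]\le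 e^{-\Omega(n)}$, and moreover the chaos property holds with parameters $(R,\mu,\nu_2)$. **Algorithms.** For an operator $X$ on a finite set of qubits let $\lVert X\rVert_{W_2}$ be the minimum of $\sum_i\lVert\frac12X_i\rVert_1^{1/2}$ (trace norms) over decompositions $X=\sum_iX_i$, indexed by the qubits, into Hermitian $X_i$ with $\mathrm{Tr}_{\{i\}}X_i=0$. A quantum algorithm $\mathcal A$ with probability space $(\Omega,\mathbb P_\Omega)$ assigns to each instance $X$ and $\omega\in\Omega$, measurably in $\omega$, an $n$-qubit mixed state $\mathcal A(X,\omega)$. For $f\in\mathbb N$, $L\ge0$, it is *$(f,L,p_{\rm st})$-stable* if for every $\kappa\in[0,1]$, with probability at least $1-p_{\rm st}$ over $\big((B,v),(B,v')\big)\sim\mathbb P_2^{(\kappa)}$ and an independent $\omega\sim\mathbb P_\Omega$, there is a set $S$ of $f$ qubits with $$\big\lVert\mathrm{Tr}_S\big(\mathcal A(B,v,\omega)-\mathcal A(B,v',\omega)\big)\big\rVert_{W_2}\le L\lVert v-v'\rVert_1 .$$ It is *$(\gamma,p_{\rm f})$-optimal* if, with probability at least $1-p_{\rm f}$ over $X\sim\mathbb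 P_1$, $\omega\sim\mathbb P_\Omega$ and the outcome $z$ of measuring $\mathcal A(X,\omega)$ in the computational basis, $g_X(z)\ge\gamma\lambda n$. **Theorem.** (1) For all integers $R\ge2$ and $Q\ge1$ there is $\delta>0$, depending only on $R$ and $Q$, such that the following holds. Suppose that the $R$-OGP with parameters $(R,\mu,\nu_1,\nu_2)$ holds. Then for all sufficiently large $n$ and all $f,L,p_{\rm st},\gamma,p_{\rm f}$ with $$p_{\rm st}+p_{\rm f}\le\delta,\qquad\gamma\ge\mu,\qquad\frac fn+\frac{\lambda L}{Q}\sqrt{\frac{Q+1}{1-(Q+1)\sqrt{3p_{\rm f}}}}<\frac{\nu_2-\nu_1}{4},$$ no quantum algorithm is both $(f,L,p_{\rm st})$-stable and $(\gamma,p_{\rm f})$-optimal. (2) Suppose that the chaos property with parameters $(R,\mu,\nu_2)$ holds. Then for all sufficiently large $n$ and all $f,L,p_{\rm st},\gamma,p_{\rm f}$ with $$p_{\rm st}+p_{\rm f}\le\tfrac1{12},\qquad p_{\rm f}<\tfrac1{12},\qquad\gamma\ge\mu,\qquad\frac fn+\lambda L\sqrt{\frac{2}{1-2\sqrt{3p_{\rm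 f}}}}<\frac{\nu_2}{4},$$ no quantum algorithm is both $(f,L,p_{\rm st})$-stable and $(\gamma,p_{\rm f})$-optimal. -/

import Mathlib

open MeasureTheory Filter Topology
open scoped ENNReal NNReal BigOperators Matrix ComplexOrder

noncomputable section

namespace StableXor

/-! ### Operators on a finite set of qubits, the quantum Wasserstein norm -/

section Qubits

/-- Bit strings on the index set `V`; they label the computational basis of the qubits `V`. -/
abbrev Bits (V : Type) : Type := V → ZMod 2

/-- Operators on the Hilbert space of the qubits `V`, as matrices in the computational basis. -/
abbrev Op (V : Type) : Type := Matrix (Bits V) (Bits V) ℂ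

variable {V : Type} [Fintype V] [DecidableEq V]

/-- Mixed states on the qubits `V`: positive semidefinite operators of trace one. -/
def MixedState (V : Type) [Fintype V] [DecidableEq V] : Type :=
  {ρ : Op V // ρ.PosSemidef ∧ ρ.trace = 1}

/-- The bit string which is `c` on `S` and `a` off `S`. -/
def glue (S : Finset V) (a : Bits {v : V // v ∉ S}) (c : Bits {v : V // v ∈ S}) : Bits V :=
  fun v => if h : v ∈ S then c ⟨v, h⟩ else a ⟨v, h⟩

/-- Partial trace over the qubits in `S`. -/
def partialTrace (S : Finset V) (X : Op V) : Op {v : V // v ∉ S} :=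
  Matrix.of fun a b => ∑ c : Bits {v : V // v ∈ S}, X (glue S a c) (glue S b c)

/-- Trace norm: the sum of the singular values, i.e. of the square roots of the
eigenvalues of `Xᴴ * X`. -/
def traceNorm {ι : Type} [Fintype ι] [DecidableEq ι] (X : Matrix ι ι ℂ) : ℝ :=
  ∑ i, Real.sqrt ((Matrix.isHermitian_conjTranspose_mul_self X).eigenvalues i)

/-- Decompositions of `X` into Hermitian operators `Y i` whose partial trace over the single
qubit `i` vanishes. -/
def wassersteinDecomp (X : Op V) : Set (V → Op V) :=
  {Y | ∑ i, Y i = X ∧ ∀ i, (Y i).IsHermitian ∧ partialTrace {i} (Y i) = 0}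

/-- Quantum Wasserstein `F`-norm of order `p`. (The value is `⊤` if there is no decomposition,
which does not happen for a traceless Hermitian `X`.) -/
def wassersteinNorm (p : ℝ) (X : Op V) : ℝ≥0∞ :=
  ⨅ Y ∈ wassersteinDecomp X, ENNReal.ofReal (∑ i, traceNorm ((1 / 2 : ℂ) • Y i) ^ (1 / p))

/-- Probability that the measurement of `ρ` in the computational basis yields an outcome
in `E` (Born rule). -/
def measureProb (ρ : MixedState V) (E : Set (Bits V)) : ℝ :=
  ∑ z : Bits V, E.indicator (fun z => (ρ.1 z z).re) z

end Qubits

/-! ### MAX-k-XOR-SAT and the transposed Gallager ensemble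

The parameters are the clause size `k`, the variable degree `d` and the number `l` of variables
per layer: there are `n = k * l` variables and `m = d * l` clauses. -/

/-- The `n = k * l` variables; `(i, c)` is the variable number `c` in the layer (block) `i`. -/
abbrev Var (k l : ℕ) : Type := Fin k × Fin l

/-- The `m = d * l` clauses. -/
abbrev Clause (d l : ℕ) : Type := Fin (d * l)

/-- Number of variables, as a real number. -/
def numVar (k l : ℕ) : ℝ := ((k * l : ℕ) : ℝ)

/-- Clause density `m / n = d / k`. -/
def density (k d : ℕ) : ℝ := (d : ℝ) / (k : ℝ)

/-- An instance: a constraint matrix and a vector of parities. -/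
abbrev Inst (k d l : ℕ) : Type :=
  Matrix (Clause d l) (Var k l) (ZMod 2) × (Clause d l → ZMod 2)

/-- The number of clauses satisfied by `z`. -/
def satCount {k d l : ℕ} (X : Inst k d l) (z : Bits (Var k l)) : ℝ :=
  ((d * l : ℕ) : ℝ) - (hammingNorm (X.1.mulVec z + X.2) : ℝ)

/-- A layer: a bipartite graph with `d * l` left nodes of degree one and `l` right nodes of
degree `d`, given by the neighbour of each left node. -/
abbrev Layer (d l : ℕ) : Type :=
  {φ : Clause d l → Fin l // ∀ j : Fin l, (Finset.univ.filter fun i => φ i = j).card = d}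

instance layerNonempty (d l : ℕ) : Nonempty (Layer d l) := by
  refine ⟨⟨fun i => (finProdFinEquiv.symm i).2, fun j => ?_⟩⟩
  have h : (Finset.univ.filter fun i : Clause d l => (finProdFinEquiv.symm i).2 = j)
      = (Finset.univ : Finset (Fin d)).map
          ⟨fun a => finProdFinEquiv (a, j), fun a b hab => by simpa using hab⟩ := by
    ext i
    simp only [Finset.mem_filter, Finset.mem_univ, true_and, Finset.mem_map]
    constructor
    · intro hi
      refine ⟨(finProdFinEquiv.symm i).1, ?_⟩
      rw [← hi]
      exact finProdFinEquiv.apply_symm_apply i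
    · rintro ⟨a, rfl⟩
      exact congrArg Prod.snd (finProdFinEquiv.symm_apply_apply (a, j))
  rw [h]
  simp

/-- The parity check matrix (checks times bits) of the merge of `k` layers. -/
def parityCheck {k d l : ℕ} (G : Fin k → Layer d l) :
    Matrix (Var k l) (Clause d l) (ZMod 2) :=
  Matrix.of fun x i => if (G x.1).1 i = x.2 then 1 else 0

/-- The Gallager ensemble: `k` independent uniformly random layers, merged. -/
def gallager (k d l : ℕ) : PMF (Matrix (Var k l) (Clause d l) (ZMod 2)) :=
  (PMF.uniformOfFintype (Fin k → Layer d l)).map parityCheck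

/-- The law of the constraint matrix: the transpose of a Gallager matrix. -/
def conLaw (k d l : ℕ) : PMF (Matrix (Clause d l) (Var k l) (ZMod 2)) :=
  (gallager k d l).map Matrix.transpose

/-- The law of the parities: independent fair bits. -/
def parLaw (d l : ℕ) : PMF (Clause d l → ZMod 2) :=
  PMF.uniformOfFintype (Clause d l → ZMod 2)

/-- The transposed Gallager ensemble of instances. -/
def instLaw (k d l : ℕ) : PMF (Inst k d l) :=
  (conLaw k d l).bind fun B => (parLaw d l).bind fun v => PMF.pure (B, v)

/-- The parities `v ⊕ Υ (v ⊕ w)`, where `Υ` projects onto the first `p` clauses with respect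
to the order `σ` of the clauses. -/
def resample {d l : ℕ} (σ : Equiv.Perm (Clause d l)) (p : ℕ) (v w : Clause d l → ZMod 2) :
    Clause d l → ZMod 2 :=
  fun i => v i + if (σ i : ℕ) < p then v i + w i else 0

/-- The `(κ, R)`-correlated ensemble: a constraint matrix `B`, parities `v`, a uniformly random
order `σ` of the clauses, and `R` instances with constraint matrix `B`; the first one has the
parities `v`, and each other one has the parities `v` with those of the first `⌊κ m⌋` clauses in
the order `σ` replaced by fresh ones. -/
def corrLaw (k d l R : ℕ) (κ : ℝ) : PMF (Fin R → Inst k d l) :=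
  (conLaw k d l).bind fun B => (parLaw d l).bind fun v =>
    (PMF.uniformOfFintype (Fin R → Clause d l → ZMod 2)).bind fun w =>
      (PMF.uniformOfFintype (Equiv.Perm (Clause d l))).bind fun σ =>
        PMF.pure fun r =>
          (B, if (r : ℕ) = 0 then v else resample σ ⌊κ * ((d * l : ℕ) : ℝ)⌋₊ v (w r))

/-! ### The overlap gap property and the chaos property -/

/-- The `k`-minimum Hamming semimetric. -/
def minHamming {k l : ℕ} (z z' : Bits (Var k l)) : ℕ :=
  ∑ i : Fin k, min (hammingDist (fun c => z (i, c)) (fun c => z' (i, c)))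
    (l - hammingDist (fun c => z (i, c)) (fun c => z' (i, c)))

/-- The set of `R`-tuples of solutions of satisfied fraction at least `μ` and with all pairwise
distances in `[ν₁ n, ν₂ n]`. -/
def overlapSet {k d l R : ℕ} (X : Fin R → Inst k d l) (μ ν₁ ν₂ : ℝ) :
    Set (Fin R → Bits (Var k l)) :=
  {z | (∀ r, μ * density k d * numVar k l ≤ satCount (X r) (z r)) ∧
    ∀ r r', r ≠ r' →
      (minHamming (z r) (z r') : ℝ) ∈ Set.Icc (ν₁ * numVar k l) (ν₂ * numVar k l)}

/-- The probability of a nonempty overlap set is at most `exp (- Ω (n))` under the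
`(κ, R)`-correlated ensemble. -/
def OverlapBound (k d R : ℕ) (κ μ ν₁ ν₂ : ℝ) : Prop :=
  ∃ c : ℝ, 0 < c ∧ ∀ᶠ l : ℕ in atTop,
    (corrLaw k d l R κ).toOuterMeasure {X | (overlapSet X μ ν₁ ν₂).Nonempty}
      ≤ ENNReal.ofReal (Real.exp (-(c * numVar k l)))

/-- The chaos property with parameters `(R, μs, ν₂)`. -/
def HasChaos (k d R : ℕ) (μs ν₂ : ℝ) : Prop :=
  ∀ μ : ℝ, μs ≤ μ → OverlapBound k d R 1 μ 0 ν₂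

/-- The `R`-OGP with parameters `(R, μs, ν₁, ν₂)`: tuples of near-optimal solutions of correlated
instances have no pairwise distances in `[ν₁ n, ν₂ n]`, and those of independent instances are
far apart. -/
def HasROGP (k d R : ℕ) (μs ν₁ ν₂ : ℝ) : Prop :=
  (∀ κ ∈ Set.Icc (0 : ℝ) 1, ∀ μ : ℝ, μs ≤ μ → OverlapBound k d R κ μ ν₁ ν₂) ∧
    HasChaos k d R μs ν₂

/-! ### Stable and near-optimal quantum algorithms -/

/-- A (randomized) quantum algorithm with sample space `Ω`: a measurable assignment of an
`n`-qubit mixed state to each instance and each sample. -/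
structure QAlg (k d l : ℕ) (Ω : Type*) [MeasurableSpace Ω] where
  state : Inst k d l → Ω → MixedState (Var k l)
  measurable_state : ∀ X z z', Measurable fun ω => (state X ω).1 z z'

/-- After discarding some set of `f` qubits, the outputs on `X` and `X'` are at distance at most
`L ‖v - v'‖₁` in the quantum Wasserstein distance of order `2`. -/
def StableAt {k d l : ℕ} {Ω : Type*} [MeasurableSpace Ω] (A : QAlg k d l Ω)
    (f : ℕ) (L : ℝ≥0) (X X' : Inst k d l) (ω : Ω) : Prop :=
  ∃ S : Finset (Var k l), S.card = f ∧
    wassersteinNorm 2 (partialTrace S ((A.state X ω).1 - (A.state X' ω).1))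
      ≤ (L : ℝ≥0∞) * (hammingDist X.2 X'.2 : ℝ≥0∞)

/-- `(f, L, pst)`-stability: for every `κ`, over a `κ`-correlated pair of instances and the
randomness of the algorithm, the stability bound fails with probability at most `pst`. -/
def IsStable {k d l : ℕ} {Ω : Type*} [MeasurableSpace Ω] (P : Measure Ω) (A : QAlg k d l Ω)
    (f : ℕ) (L : ℝ≥0) (pst : ℝ) : Prop :=
  ∀ κ ∈ Set.Icc (0 : ℝ) 1,
    ∑ X : Fin 2 → Inst k d l,
      (corrLaw k d l 2 κ X).toReal * P.real {ω | ¬ StableAt A f L (X 0) (X 1) ω} ≤ pst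

/-- `(γ, pf)`-optimality: with probability at least `1 - pf` over the instance, the randomness
of the algorithm and the measurement in the computational basis, the measured string satisfies
at least `γ λ n` clauses. -/
def IsOptimal {k d l : ℕ} {Ω : Type*} [MeasurableSpace Ω] (P : Measure Ω) (A : QAlg k d l Ω)
    (γ pf : ℝ) : Prop :=
  1 - pf ≤ ∑ X : Inst k d l, (instLaw k d l X).toReal *
    ∫ ω, measureProb (A.state X ω) {z | γ * density k d * numVar k l ≤ satCount X z} ∂P

end StableXor

end

open StableXor

universe u

noncomputable section

namespace StableXor

/-! ### The trace norm dominates the diagonal -/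

lemma sum_norm_diag_le_traceNorm {ι : Type} [Fintype ι] [DecidableEq ι] (X : Matrix ι ι ℂ) :
    ∑ z, ‖X z z‖ ≤ traceNorm X := by
  set hH := Matrix.isHermitian_conjTranspose_mul_self X
  set U : Matrix ι ι ℂ := (hH.eigenvectorUnitary : Matrix ι ι ℂ) with hU
  have hU1 : U * Uᴴ = 1 := Unitary.coe_mul_star_self hH.eigenvectorUnitary
  have hU2 : Uᴴ * U = 1 := Unitary.coe_star_mul_self hH.eigenvectorUnitary
  -- The columns of `M` have the singular values of `X` as lengths. Since `X z z` is the sum over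
  -- `j` of `M z j` times the conjugate of `U z j`, Cauchy–Schwarz in `z` for each `j` gives the
  -- bound.
  set M := X * U with hM
  have hX : X = M * Uᴴ := by rw [hM, Matrix.mul_assoc, hU1, Matrix.mul_one]
  have hMM : Mᴴ * M = Matrix.diagonal (RCLike.ofReal ∘ hH.eigenvalues) := by
    have h := hH.spectral_theorem
    rw [Unitary.conjStarAlgAut_apply] at h
    have h' : Xᴴ * X = U * Matrix.diagonal (RCLike.ofReal ∘ hH.eigenvalues) * Uᴴ := h
    rw [hM, Matrix.conjTranspose_mul, Matrix.mul_assoc, ← Matrix.mul_assoc Xᴴ]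
    calc Uᴴ * (Xᴴ * X * U) = Uᴴ * (U * Matrix.diagonal (RCLike.ofReal ∘ hH.eigenvalues) * Uᴴ * U) :=
          congrArg (fun N => Uᴴ * (N * U)) h'
      _ = (Uᴴ * U) * Matrix.diagonal (RCLike.ofReal ∘ hH.eigenvalues) * (Uᴴ * U) := by
          simp only [Matrix.mul_assoc]
      _ = _ := by rw [hU2, Matrix.one_mul, Matrix.mul_one]
  have hcol : ∀ (N : Matrix ι ι ℂ) (j : ι), (Nᴴ * N) j j = ((∑ z, ‖N z j‖ ^ 2 : ℝ) : ℂ) := by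
    intro N j
    rw [Matrix.mul_apply]
    push_cast
    refine Finset.sum_congr rfl fun z _ => ?_
    rw [Matrix.conjTranspose_apply]
    exact RCLike.conj_mul (N z j)
  have hMcol : ∀ j, ∑ z, ‖M z j‖ ^ 2 = hH.eigenvalues j := by
    intro j
    have h := hcol M j
    rw [hMM, Matrix.diagonal_apply_eq] at h
    exact (Complex.ofReal_injective h).symm
  have hUcol : ∀ j, ∑ z, ‖U z j‖ ^ 2 = 1 := by
    intro j
    have h := hcol U j
    rw [hU2, Matrix.one_apply_eq] at h
    exact_mod_cast h.symm
  calc ∑ z, ‖X z z‖ ≤ ∑ z, ∑ j, ‖M z j‖ * ‖U z j‖ := by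
        refine Finset.sum_le_sum fun z _ => ?_
        conv_lhs => rw [hX, Matrix.mul_apply]
        refine (norm_sum_le _ _).trans (Finset.sum_le_sum fun j _ => ?_)
        rw [norm_mul, Matrix.conjTranspose_apply, norm_star]
    _ = ∑ j, ∑ z, ‖M z j‖ * ‖U z j‖ := Finset.sum_comm
    _ ≤ traceNorm X := by
        refine Finset.sum_le_sum fun j _ => ?_
        refine (Real.sum_mul_le_sqrt_mul_sqrt _ _ _).trans ?_
        rw [hMcol, hUcol, Real.sqrt_one, mul_one]

/-! ### Couplings -/

/-- `π` is a coupling of the (finite) mass distributions `p` and `q`. -/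
structure IsCoupling {α : Type} [Fintype α] (p q : α → ℝ) (π : α → α → ℝ) : Prop where
  nonneg : ∀ a b, 0 ≤ π a b
  fst : ∀ a, ∑ b, π a b = p a
  snd : ∀ b, ∑ a, π a b = q b

/-! ### Realizing hypercube flows by couplings -/

section Flow

variable {V : Type} [Fintype V] [DecidableEq V]

/-- Flip the bit `i`. -/
def flipBit (i : V) (z : Bits V) : Bits V := Function.update z i (z i + 1)

omit [Fintype V] in
lemma flipBit_flipBit (i : V) (z : Bits V) : flipBit i (flipBit i z) = z := by
  have h : z i + 1 + 1 = z i := by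
    rw [add_assoc, show (1 + 1 : ZMod 2) = 0 by decide, add_zero]
  simp [flipBit, h]

omit [Fintype V] in
lemma flipBit_ne (i : V) (z : Bits V) : flipBit i z ≠ z := by
  intro h
  have h' := congrFun h i
  simp [flipBit] at h'

omit [Fintype V] in
lemma flipBit_eq_iff (i : V) (z w : Bits V) : flipBit i z = w ↔ z = flipBit i w :=
  ⟨fun h => by rw [← h, flipBit_flipBit], fun h => by rw [h, flipBit_flipBit]⟩

/-- The mass that a coupling `π` moves across the coordinate `i`. -/
def crossMass (π : Bits V → Bits V → ℝ) (i : V) : ℝ :=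
  ∑ a, ∑ b, if a i ≠ b i then π a b else 0

lemma sum_flipBit (i : V) (g : Bits V → ℝ) : ∑ z, g (flipBit i z) = ∑ z, g z :=
  Equiv.sum_comp (Function.Involutive.toPerm (flipBit i) (flipBit_flipBit i)) g

/-- The feasible pairs of a partial transport `π` out of `p` and a residual flow `y` into `q`
within the budget `c`. -/
def transportSet (p q : Bits V → ℝ) (c : V → ℝ) :
    Set ((Bits V → Bits V → ℝ) × (V → Bits V → ℝ)) :=
  {x | (∀ a b, 0 ≤ x.1 a b) ∧ (∀ i z, 0 ≤ x.2 i z) ∧ (∀ a, ∑ b, x.1 a b = p a) ∧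
    (∀ b, ∑ a, x.1 a b - q b = ∑ i, (x.2 i b - x.2 i (flipBit i b))) ∧
    ∀ i, crossMass x.1 i + ∑ z, x.2 i z ≤ c i}

lemma crossMass_nonneg {π : Bits V → Bits V → ℝ} (h : ∀ a b, 0 ≤ π a b) (i : V) :
    0 ≤ crossMass π i :=
  Finset.sum_nonneg fun a _ => Finset.sum_nonneg fun b _ => by split_ifs <;> simp [h]

lemma isCompact_transportSet (p q : Bits V → ℝ) (c : V → ℝ) :
    IsCompact (transportSet p q c) := by
  have hsub : transportSet p q c ⊆ Set.Icc 0 (fun a _ => p a, fun i _ => c i) := by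
    rintro ⟨π, y⟩ ⟨h1, h2, h3, -, h5⟩
    refine ⟨⟨fun a b => h1 a b, fun i z => h2 i z⟩, fun a b => ?_, fun i z => ?_⟩
    · change π a b ≤ p a
      rw [← h3 a]
      exact Finset.single_le_sum (fun b _ => h1 a b) (Finset.mem_univ b)
    · have h6 : y i z ≤ ∑ z, y i z :=
        Finset.single_le_sum (fun z _ => h2 i z) (Finset.mem_univ z)
      have h7 := h5 i
      have h8 := crossMass_nonneg h1 i
      change y i z ≤ c i
      simp only at h7 h8
      linarith
  refine IsCompact.of_isClosed_subset isCompact_Icc ?_ hsub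
  have hc : ∀ i : V, Continuous fun x : (Bits V → Bits V → ℝ) × (V → Bits V → ℝ) =>
      crossMass x.1 i := by
    intro i
    unfold crossMass
    refine continuous_finsetSum _ fun a _ => continuous_finsetSum _ fun b _ => ?_
    split_ifs
    · fun_prop
    · fun_prop
  simp only [transportSet, Set.ofPred_and, Set.ofPred_forall]
  refine IsClosed.inter ?_ (IsClosed.inter ?_ (IsClosed.inter ?_ (IsClosed.inter ?_ ?_)))
  · exact isClosed_iInter fun a => isClosed_iInter fun b =>
      isClosed_le continuous_const (by fun_prop)
  · exact isClosed_iInter fun a => isClosed_iInter fun b =>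
      isClosed_le continuous_const (by fun_prop)
  · exact isClosed_iInter fun a => isClosed_eq (by fun_prop) continuous_const
  · exact isClosed_iInter fun a => isClosed_eq (by fun_prop) (by fun_prop)
  · exact isClosed_iInter fun i => isClosed_le ((hc i).add (by fun_prop)) continuous_const

/-- One transport step: mass at `z₀` is moved along the residual flow in direction `i`. -/
lemma exists_transportSet_step {p q : Bits V → ℝ} {c : V → ℝ}
    {x : (Bits V → Bits V → ℝ) × (V → Bits V → ℝ)} (hx : x ∈ transportSet p q c)
    {i : V} {z₀ : Bits V} (hr : 0 < ∑ a, x.1 a z₀) (hy : 0 < x.2 i z₀) :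
    ∃ x' ∈ transportSet p q c, ∑ j, ∑ z, x'.2 j z < ∑ j, ∑ z, x.2 j z := by
  obtain ⟨π, y⟩ := x
  obtain ⟨h1, h2, h3, h4, h5⟩ := hx
  simp only at hr hy h1 h2 h3 h4 h5
  set r := ∑ a, π a z₀ with hrdef
  -- This is the largest amount that keeps both the residual flow and the mass at `z₀` nonnegative.
  -- Every source gives up the same fraction `θ` of its mass at `z₀`, and row sums do not change.
  set ε := min (y i z₀) r
  have hε : 0 < ε := lt_min hy hr
  have hεy : ε ≤ y i z₀ := min_le_left _ _
  have hεr : ε ≤ r := min_le_right _ _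
  set θ := ε / r
  have hθ0 : 0 ≤ θ := div_nonneg hε.le hr.le
  have hθ1 : θ ≤ 1 := (div_le_one hr).2 hεr
  have hθr : θ * r = ε := div_mul_cancel₀ _ hr.ne'
  set w := flipBit i z₀ with hw
  have hwz : w ≠ z₀ := flipBit_ne i z₀
  set π' : Bits V → Bits V → ℝ := fun a b =>
    π a b + θ * π a z₀ * ((if b = w then 1 else 0) - if b = z₀ then 1 else 0) with hπ'
  set y' : V → Bits V → ℝ := fun j z => y j z - if j = i ∧ z = z₀ then ε else 0 with hy'
  have hysum : ∀ j, ∑ z, y' j z = ∑ z, y j z - if j = i then ε else 0 := by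
    intro j
    by_cases hj : j = i <;> simp [hy', hj, Finset.sum_sub_distrib]
  refine ⟨(π', y'), ⟨fun a b => ?_, fun j z => ?_, fun a => ?_, fun b => ?_, fun j => ?_⟩, ?_⟩
  · change 0 ≤ π' a b
    by_cases hb : b = z₀
    · subst hb
      have : π' a b = (1 - θ) * π a b := by simp [hπ', hwz.symm]; ring
      rw [this]
      exact mul_nonneg (by linarith) (h1 a b)
    · have : 0 ≤ θ * π a z₀ := mul_nonneg hθ0 (h1 _ _)
      have h0 := h1 a b
      simp only [hπ', if_neg hb]
      split_ifs <;> linarith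
  · change 0 ≤ y' j z
    simp only [hy']
    split_ifs with h
    · rw [h.1, h.2]; linarith
    · simpa using h2 j z
  · simp [hπ', Finset.sum_add_distrib, ← Finset.mul_sum, h3]
  · have hcol : ∑ a, π' a b = ∑ a, π a b
        + ε * ((if b = w then 1 else 0) - if b = z₀ then 1 else 0) := by
      simp only [hπ', Finset.sum_add_distrib, ← Finset.sum_mul, ← Finset.mul_sum]
      rw [← hrdef, hθr]
    have hflow : ∑ j, (y' j b - y' j (flipBit j b)) = ∑ j, (y j b - y j (flipBit j b))
        + ε * ((if b = w then 1 else 0) - if b = z₀ then 1 else 0) := by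
      rw [← sub_eq_iff_eq_add', ← Finset.sum_sub_distrib]
      rw [Finset.sum_eq_single i]
      · simp only [hy', true_and, flipBit_eq_iff, ← hw]
        split_ifs <;> ring
      · intro j _ hj
        simp [hy', hj]
      · simp
    change ∑ a, π' a b - q b = ∑ j, (y' j b - y' j (flipBit j b))
    rw [hcol, hflow, ← h4 b]
    ring
  · change crossMass π' j + ∑ z, y' j z ≤ c j
    -- The points `z₀` and `w` differ only in bit `i`, so only the crossing mass of coordinate `i`
    -- can grow, by at most the `ε` just removed from the residual flow in that direction. The
    -- budget is preserved.
    have hcm : crossMass π' j ≤ crossMass π j + if j = i then ε else 0 := by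
      have hrow : ∀ a, (∑ b, if a j ≠ b j then π' a b else 0)
          ≤ (∑ b, if a j ≠ b j then π a b else 0) + if j = i then θ * π a z₀ else 0 := by
        intro a
        have hsplit : ∀ b, (if a j ≠ b j then π' a b else 0)
            = (if a j ≠ b j then π a b else 0)
              + (if b = w then (if a j ≠ w j then θ * π a z₀ else 0) else 0)
              - (if b = z₀ then (if a j ≠ z₀ j then θ * π a z₀ else 0) else 0) := by
          intro b
          by_cases hb1 : b = w
          · rw [hb1]
            by_cases hb : a j = w j <;> simp [hπ', hb, hwz]
          · by_cases hb2 : b = z₀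
            · subst hb2
              by_cases hb : a j ≠ b j <;> simp [hπ', hb, hb1]
              ring
            · simp [hπ', hb1, hb2]
        have hnn : 0 ≤ θ * π a z₀ := mul_nonneg hθ0 (h1 _ _)
        simp only [hsplit, Finset.sum_sub_distrib, Finset.sum_add_distrib, Finset.sum_ite_eq',
          Finset.mem_univ, if_true]
        by_cases hj : j = i
        · rw [if_pos hj]
          split_ifs <;> linarith
        · have : w j = z₀ j := by simp [hw, flipBit, hj]
          rw [this, if_neg hj]
          linarith
      calc crossMass π' j ≤ ∑ a, ((∑ b, if a j ≠ b j then π a b else 0)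
            + if j = i then θ * π a z₀ else 0) := Finset.sum_le_sum fun a _ => hrow a
        _ = crossMass π j + if j = i then ε else 0 := by
          rw [Finset.sum_add_distrib]
          by_cases hj : j = i
          · simp only [hj, if_true, ← Finset.mul_sum, ← hrdef, hθr]
            rfl
          · simp only [hj, if_false, Finset.sum_const_zero]
            rfl
    have := h5 j
    rw [hysum]
    linarith
  · change ∑ j, ∑ z, y' j z < ∑ j, ∑ z, y j z
    simp only [hysum, Finset.sum_sub_distrib, Finset.sum_ite_eq', Finset.mem_univ, if_true]
    linarith

/-- A flow on the hypercube from `p` to `q` is realized by a coupling. -/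
lemma exists_coupling_of_flow {p q : Bits V → ℝ} (hp : ∀ z, 0 ≤ p z) (hq : ∀ z, 0 ≤ q z)
    {y : V → Bits V → ℝ} (hy : ∀ i z, 0 ≤ y i z)
    (hflow : ∀ z, p z - q z = ∑ i, (y i z - y i (flipBit i z))) :
    ∃ π, IsCoupling p q π ∧ ∀ i, crossMass π i ≤ ∑ z, y i z := by
  -- Start with the identity coupling: nothing has been moved and the whole flow is residual.
  have hne : (transportSet p q fun i => ∑ z, y i z).Nonempty := by
    refine ⟨(fun a b => if a = b then p a else 0, y), fun a b => ?_, hy, fun a => ?_,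
      fun b => ?_, fun i => ?_⟩
    · dsimp only
      split_ifs
      · exact hp a
      · exact le_rfl
    · simp
    · simpa using hflow b
    · have : crossMass (fun a b => if a = b then p a else 0) i = 0 := by
        refine Finset.sum_eq_zero fun a _ => Finset.sum_eq_zero fun b _ => ?_
        by_cases hab : a = b <;> simp [hab]
      rw [this, zero_add]
  -- Minimize the total residual flow. At a point with excess mass some residual flow leaves, and a
  -- transport step would lower the total, so the minimizer has no excess. A leftover circulation is
  -- harmless.
  obtain ⟨⟨π, y'⟩, hx, hmin⟩ := (isCompact_transportSet p q _).exists_isMinOn hne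
    (f := fun x => ∑ j, ∑ z, x.2 j z) (by fun_prop)
  have hle : ∀ z, ∑ a, π a z ≤ q z := by
    intro z
    by_contra! hlt
    have h4 := hx.2.2.2.1 z
    simp only at h4
    have hpos : ∑ i : V, (0 : ℝ) < ∑ i, (y' i z - y' i (flipBit i z)) := by
      rw [← h4]; simp; linarith
    obtain ⟨i, -, hi⟩ := Finset.exists_lt_of_sum_lt hpos
    have h2 := hx.2.1 i (flipBit i z)
    simp only at h2
    obtain ⟨x', hx', hlt'⟩ := exists_transportSet_step hx (i := i) (z₀ := z)
      (lt_of_le_of_lt (hq z) hlt) (by simp only; linarith)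
    exact absurd (isMinOn_iff.1 hmin x' hx') (not_le.2 hlt')
  have hsum : ∑ z, ∑ a, π a z = ∑ z, q z := by
    rw [← sub_eq_zero, ← Finset.sum_sub_distrib]
    have h4 : ∀ z, ∑ a, π a z - q z = ∑ i, (y' i z - y' i (flipBit i z)) := hx.2.2.2.1
    simp only [h4]
    rw [Finset.sum_comm]
    refine Finset.sum_eq_zero fun i _ => ?_
    rw [Finset.sum_sub_distrib, sum_flipBit i (y' i), sub_self]
  have heq := (Finset.sum_eq_sum_iff_of_le fun z _ => hle z).1 hsum
  refine ⟨π, ⟨hx.1, hx.2.2.1, fun b => heq b (Finset.mem_univ b)⟩, fun i => ?_⟩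
  have h5 : crossMass π i + ∑ z, y' i z ≤ ∑ z, y i z := hx.2.2.2.2 i
  have h2 : 0 ≤ ∑ z, y' i z := Finset.sum_nonneg fun z _ => hx.2.1 i z
  linarith

/-- Second moment tail bound for the Hamming distance under a coupling. -/
lemma tail_mul_sq_le {p q : Bits V → ℝ} {π : Bits V → Bits V → ℝ} (h : IsCoupling p q π)
    {c : V → ℝ} (hc : ∀ i, crossMass π i ≤ c i) {s : ℝ} (hs : 0 ≤ s) :
    (∑ a, ∑ b, if s < (hammingDist a b : ℝ) then π a b else 0) * s ^ 2
      ≤ (∑ i, Real.sqrt (c i)) ^ 2 := by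
  have hd : ∀ a b : Bits V, (hammingDist a b : ℝ) = ∑ i, if a i ≠ b i then (1 : ℝ) else 0 := by
    intro a b
    rw [hammingDist, Finset.card_filter]
    push_cast
    rfl
  have hpt : ∀ a b, (if s < (hammingDist a b : ℝ) then π a b else 0) * s ^ 2
      ≤ ∑ i, ∑ j, if a i ≠ b i ∧ a j ≠ b j then π a b else 0 := by
    intro a b
    have h1 : ∑ i, ∑ j, (if a i ≠ b i ∧ a j ≠ b j then π a b else 0)
        = π a b * (hammingDist a b : ℝ) ^ 2 := by
      rw [hd, sq, Finset.sum_mul_sum, Finset.mul_sum]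
      refine Finset.sum_congr rfl fun i _ => ?_
      rw [Finset.mul_sum]
      refine Finset.sum_congr rfl fun j _ => ?_
      by_cases hi : a i ≠ b i <;> by_cases hj : a j ≠ b j <;> simp [hi, hj]
    rw [h1]
    split_ifs with hlt
    · exact mul_le_mul_of_nonneg_left (pow_le_pow_left₀ hs hlt.le 2) (h.nonneg a b)
    · rw [zero_mul]
      exact mul_nonneg (h.nonneg a b) (sq_nonneg _)
  -- The probability that both coordinates differ is at most the smaller of `c i` and `c j`, hence
  -- at most their geometric mean. This makes the second moment a perfect square.
  have hij : ∀ i j, (∑ a, ∑ b, if a i ≠ b i ∧ a j ≠ b j then π a b else 0)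
      ≤ Real.sqrt (c i) * Real.sqrt (c j) := by
    intro i j
    set m := ∑ a, ∑ b, if a i ≠ b i ∧ a j ≠ b j then π a b else 0
    have hm : 0 ≤ m := Finset.sum_nonneg fun a _ => Finset.sum_nonneg fun b _ => by
      split_ifs <;> simp [h.nonneg]
    have hmi : m ≤ c i := le_trans (Finset.sum_le_sum fun a _ => Finset.sum_le_sum fun b _ => by
      by_cases hi : a i ≠ b i <;> by_cases hj : a j ≠ b j <;> simp [hi, hj, h.nonneg]) (hc i)
    have hmj : m ≤ c j := le_trans (Finset.sum_le_sum fun a _ => Finset.sum_le_sum fun b _ => by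
      by_cases hi : a i ≠ b i <;> by_cases hj : a j ≠ b j <;> simp [hi, hj, h.nonneg]) (hc j)
    calc m = Real.sqrt m * Real.sqrt m := (Real.mul_self_sqrt hm).symm
      _ ≤ _ := mul_le_mul (Real.sqrt_le_sqrt hmi) (Real.sqrt_le_sqrt hmj) (Real.sqrt_nonneg _)
        (Real.sqrt_nonneg _)
  calc (∑ a, ∑ b, if s < (hammingDist a b : ℝ) then π a b else 0) * s ^ 2
      ≤ ∑ a, ∑ b, ∑ i, ∑ j, (if a i ≠ b i ∧ a j ≠ b j then π a b else 0) := by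
        rw [Finset.sum_mul]
        refine Finset.sum_le_sum fun a _ => ?_
        rw [Finset.sum_mul]
        exact Finset.sum_le_sum fun b _ => hpt a b
    _ = ∑ i, ∑ j, ∑ a, ∑ b, (if a i ≠ b i ∧ a j ≠ b j then π a b else 0) := by
        calc _ = ∑ a, ∑ i, ∑ b, ∑ j, (if a i ≠ b i ∧ a j ≠ b j then π a b else 0) :=
              Finset.sum_congr rfl fun a _ => Finset.sum_comm
          _ = ∑ i, ∑ a, ∑ b, ∑ j, (if a i ≠ b i ∧ a j ≠ b j then π a b else 0) :=
              Finset.sum_comm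
          _ = ∑ i, ∑ a, ∑ j, ∑ b, (if a i ≠ b i ∧ a j ≠ b j then π a b else 0) :=
              Finset.sum_congr rfl fun i _ => Finset.sum_congr rfl fun a _ => Finset.sum_comm
          _ = _ := Finset.sum_congr rfl fun i _ => Finset.sum_comm
    _ ≤ ∑ i, ∑ j, Real.sqrt (c i) * Real.sqrt (c j) :=
        Finset.sum_le_sum fun i _ => Finset.sum_le_sum fun j _ => hij i j
    _ = _ := by rw [sq, Finset.sum_mul_sum]

end Flow

/-- A coupling of the images of `p` and `q` under `g` lifts to a coupling of `p` and `q`. -/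
lemma IsCoupling.lift {α β : Type} [Fintype α] [Fintype β] [DecidableEq β] (g : α → β)
    {p q : α → ℝ} (hp : ∀ a, 0 ≤ p a) (hq : ∀ a, 0 ≤ q a) {κ : β → β → ℝ}
    (h : IsCoupling (fun b => ∑ a, if g a = b then p a else 0)
      (fun b => ∑ a, if g a = b then q a else 0) κ) :
    ∃ π, IsCoupling p q π ∧ ∀ F : β → β → ℝ,
      ∑ a, ∑ a', π a a' * F (g a) (g a') = ∑ b, ∑ b', κ b b' * F b b' := by
  set P : β → ℝ := fun b => ∑ a, if g a = b then p a else 0 with hP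
  set Q : β → ℝ := fun b => ∑ a, if g a = b then q a else 0 with hQ
  have hP0 : ∀ b b', P b = 0 → κ b b' = 0 := fun b b' h0 => by
    have := h.fst b
    rw [h0] at this
    exact (Finset.sum_eq_zero_iff_of_nonneg fun b' _ => h.nonneg b b').1 this b'
      (Finset.mem_univ _)
  have hQ0 : ∀ b b', Q b' = 0 → κ b b' = 0 := fun b b' h0 => by
    have := h.snd b'
    rw [h0] at this
    exact (Finset.sum_eq_zero_iff_of_nonneg fun b _ => h.nonneg b b').1 this b
      (Finset.mem_univ _)
  have hPn : ∀ b, 0 ≤ P b := fun b => Finset.sum_nonneg fun a _ => by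
    split_ifs <;> simp [hp]
  have hQn : ∀ b, 0 ≤ Q b := fun b => Finset.sum_nonneg fun a _ => by
    split_ifs <;> simp [hq]
  have hfib : ∀ (u : α → ℝ) (G : β → ℝ),
      ∑ a, u a * G (g a) = ∑ b, (∑ a, if g a = b then u a else 0) * G b := by
    intro u G
    simp only [Finset.sum_mul, ite_mul, zero_mul]
    rw [Finset.sum_comm]
    simp
  have hpa : ∀ a, P (g a) = 0 → p a = 0 := fun a h0 => by
    have := (Finset.sum_eq_zero_iff_of_nonneg
      (fun a' _ => by split_ifs <;> simp [hp])).1 h0 a (Finset.mem_univ a)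
    simpa using this
  have hqa : ∀ a, Q (g a) = 0 → q a = 0 := fun a h0 => by
    have := (Finset.sum_eq_zero_iff_of_nonneg
      (fun a' _ => by split_ifs <;> simp [hq])).1 h0 a (Finset.mem_univ a)
    simpa using this
  -- Sample the images from `κ`, then draw the two preimages independently from their fibres. Where
  -- a denominator vanishes, the corresponding masses vanish too, so division by zero does no harm.
  refine ⟨fun a a' => p a * q a' * (κ (g a) (g a') / (P (g a) * Q (g a'))),
    ⟨fun a a' => ?_, fun a => ?_, fun a' => ?_⟩, fun F => ?_⟩
  · exact mul_nonneg (mul_nonneg (hp a) (hq a'))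
      (div_nonneg (h.nonneg _ _) (mul_nonneg (hPn _) (hQn _)))
  · simp only [mul_assoc, ← Finset.mul_sum]
    rw [hfib q fun b' => κ (g a) b' / (P (g a) * Q b')]
    by_cases h0 : P (g a) = 0
    · simp [hpa a h0]
    have : ∀ b', Q b' * (κ (g a) b' / (P (g a) * Q b')) = κ (g a) b' / P (g a) := by
      intro b'
      by_cases h1 : Q b' = 0
      · simp [h1, hQ0 _ _ h1]
      · field_simp
    change p a * ∑ b', Q b' * (κ (g a) b' / (P (g a) * Q b')) = p a
    simp only [this, ← Finset.sum_div]
    rw [h.fst, div_self h0, mul_one]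
  · have hre : ∀ a, p a * q a' * (κ (g a) (g a') / (P (g a) * Q (g a')))
        = q a' * (p a * (κ (g a) (g a') / (P (g a) * Q (g a')))) := fun a => by ring
    simp only [hre, ← Finset.mul_sum]
    rw [hfib p fun b => κ b (g a') / (P b * Q (g a'))]
    by_cases h0 : Q (g a') = 0
    · simp [hqa a' h0]
    have : ∀ b, P b * (κ b (g a') / (P b * Q (g a'))) = κ b (g a') / Q (g a') := by
      intro b
      by_cases h1 : P b = 0
      · simp [h1, hP0 _ _ h1]
      · field_simp
    change q a' * ∑ b, P b * (κ b (g a') / (P b * Q (g a'))) = q a'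
    simp only [this, ← Finset.sum_div]
    rw [h.snd, div_self h0, mul_one]
  · have hre : ∀ a a', p a * q a' * (κ (g a) (g a') / (P (g a) * Q (g a'))) * F (g a) (g a')
        = p a * (q a' * (κ (g a) (g a') / (P (g a) * Q (g a')) * F (g a) (g a'))) :=
      fun a a' => by ring
    simp only [hre, ← Finset.mul_sum]
    have h1 : ∀ a, ∑ a', q a' * (κ (g a) (g a') / (P (g a) * Q (g a')) * F (g a) (g a'))
        = ∑ b', Q b' * (κ (g a) b' / (P (g a) * Q b') * F (g a) b') := fun a =>
      hfib q fun b' => κ (g a) b' / (P (g a) * Q b') * F (g a) b'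
    simp only [h1]
    rw [hfib p fun b => ∑ b', Q b' * (κ b b' / (P b * Q b') * F b b')]
    refine Finset.sum_congr rfl fun b _ => ?_
    rw [Finset.mul_sum]
    refine Finset.sum_congr rfl fun b' _ => ?_
    change P b * (Q b' * (κ b b' / (P b * Q b') * F b b')) = κ b b' * F b b'
    by_cases h2 : P b = 0
    · simp [h2, hP0 _ _ h2]
    by_cases h3 : Q b' = 0
    · simp [h3, hQ0 _ _ h3]
    field_simp

/-! ### From the quantum Wasserstein norm to couplings of outcomes -/

section Quantum

variable {V : Type} [Fintype V] [DecidableEq V]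

/-- The distribution of the measurement outcome. -/
def born (ρ : MixedState V) (z : Bits V) : ℝ := (ρ.1 z z).re

lemma born_nonneg (ρ : MixedState V) (z : Bits V) : 0 ≤ born ρ z :=
  (Complex.le_def.1 (ρ.2.1.diag_nonneg (i := z))).1

lemma sum_born (ρ : MixedState V) : ∑ z, born ρ z = 1 := by
  have h := congrArg Complex.re ρ.2.2
  simpa [Matrix.trace, born] using h

/-- Forget the bits in `S`. -/
def forget (S : Finset V) (z : Bits V) : Bits {v : V // v ∉ S} := fun v => z v

lemma sum_glue {M : Type} [AddCommMonoid M] (S : Finset V) (a : Bits {v : V // v ∉ S})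
    (F : Bits V → M) : ∑ c, F (glue S a c) = ∑ z, if forget S z = a then F z else 0 := by
  rw [← Finset.sum_filter]
  refine Finset.sum_nbij' (fun c => glue S a c) (fun z v => z v) ?_ ?_ ?_ ?_ ?_
  · intro c _
    simp only [Finset.mem_filter, Finset.mem_univ, true_and]
    funext v
    simp [forget, glue, v.2]
  · intro z _
    simp
  · intro c _
    funext v
    simp [glue, v.2]
  · intro z hz
    simp only [Finset.mem_filter, Finset.mem_univ, true_and] at hz
    funext v
    by_cases hv : v ∈ S
    · simp [glue, hv]
    · simp [glue, hv, ← hz, forget]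
  · intro c _
    rfl

lemma sum_forget_singleton {M : Type} [AddCommMonoid M] (i : V) (z : Bits V) (F : Bits V → M) :
    (∑ w, if forget {i} w = forget {i} z then F w else 0) = F z + F (flipBit i z) := by
  rw [← Finset.sum_filter]
  have h : (Finset.univ.filter fun w => forget {i} w = forget {i} z) = {z, flipBit i z} := by
    ext w
    simp only [Finset.mem_filter, Finset.mem_univ, true_and, Finset.mem_insert,
      Finset.mem_singleton]
    constructor
    · intro h
      have hne : ∀ v, v ≠ i → w v = z v := fun v hv =>
        congrFun h ⟨v, by simpa using hv⟩
      have h2 : ∀ x y : ZMod 2, x = y ∨ x = y + 1 := by decide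
      rcases h2 (w i) (z i) with hi | hi
      · left
        funext v
        by_cases hv : v = i
        · rw [hv, hi]
        · exact hne v hv
      · right
        funext v
        by_cases hv : v = i
        · subst hv; simp [flipBit, hi]
        · simp [flipBit, hv, hne v hv]
    · rintro (rfl | rfl)
      · rfl
      · funext v
        have : (v : V) ≠ i := by simpa using v.2
        simp [forget, flipBit, this]
  rw [h, Finset.sum_pair (flipBit_ne i z).symm]

lemma diag_flipBit {Y : Op V} {i : V} (h : partialTrace {i} Y = 0) (z : Bits V) :
    Y (flipBit i z) (flipBit i z) = -Y z z := by
  have h1 := congrFun (congrFun h (forget {i} z)) (forget {i} z)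
  simp only [partialTrace, Matrix.of_apply, Matrix.zero_apply] at h1
  rw [sum_glue {i} _ fun w => Y w w, sum_forget_singleton] at h1
  exact (neg_eq_of_add_eq_zero_right h1).symm

/-- Classical consequence of a decomposition as in the quantum Wasserstein norm: if the diagonal
of the difference is `p - q`, then `p` and `q` have a coupling of small second moment. -/
lemma exists_coupling_of_decomp {p q : Bits V → ℝ} (hp : ∀ z, 0 ≤ p z) (hq : ∀ z, 0 ≤ q z)
    {X : Op V} (hX : ∀ z, (X z z).re = p z - q z) {Y : V → Op V}
    (hY : Y ∈ wassersteinDecomp X) :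
    ∃ π, IsCoupling p q π ∧ ∀ i, crossMass π i ≤ traceNorm ((1 / 2 : ℂ) • Y i) := by
  obtain ⟨hsum, hi⟩ := hY
  set x : V → Bits V → ℝ := fun i z => (Y i z z).re with hx
  have hflip : ∀ i z, x i (flipBit i z) = -x i z := fun i z => by
    simp [hx, diag_flipBit (hi i).2 z]
  -- The function `x i` is odd under flipping bit `i`. Its positive part is therefore a flow with
  -- divergence `x i`, and its total is half of `∑ z, |x i z|`.
  set y : V → Bits V → ℝ := fun i z => max (x i z) 0 with hy
  have hyy : ∀ i z, y i z - y i (flipBit i z) = x i z := by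
    intro i z
    simp only [hy, hflip]
    rcases le_total (x i z) 0 with h | h
    · rw [max_eq_right h, max_eq_left (by linarith)]; ring
    · rw [max_eq_left h, max_eq_right (by linarith)]; ring
  have hyabs : ∀ i z, y i z + y i (flipBit i z) = |x i z| := by
    intro i z
    simp only [hy, hflip]
    rcases le_total (x i z) 0 with h | h
    · rw [max_eq_right h, max_eq_left (by linarith), abs_of_nonpos h]; ring
    · rw [max_eq_left h, max_eq_right (by linarith), abs_of_nonneg h]; ring
  obtain ⟨π, hπ, hc⟩ := exists_coupling_of_flow hp hq (y := y) (fun i z => le_max_right _ _)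
    (fun z => by
      simp only [hyy, hx]
      rw [← hX z, ← hsum, Matrix.sum_apply, Complex.re_sum])
  refine ⟨π, hπ, fun i => (hc i).trans (le_trans ?_ (sum_norm_diag_le_traceNorm _))⟩
  have h2 : ∑ z, y i z + ∑ z, y i z = ∑ z, |x i z| := by
    calc ∑ z, y i z + ∑ z, y i z = ∑ z, y i z + ∑ z, y i (flipBit i z) := by
          rw [sum_flipBit i (y i)]
      _ = ∑ z, |x i z| := by
          rw [← Finset.sum_add_distrib]
          exact Finset.sum_congr rfl fun z _ => hyabs i z
  have h3 : ∑ z, |x i z| ≤ 2 * ∑ z, ‖((1 / 2 : ℂ) • Y i) z z‖ := by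
    rw [Finset.mul_sum]
    refine Finset.sum_le_sum fun z _ => ?_
    rw [Matrix.smul_apply, norm_smul]
    have := Complex.abs_re_le_norm (Y i z z)
    norm_num
    linarith
  linarith

lemma re_partialTrace_diag (S : Finset V) (ρ ρ' : MixedState V) (a : Bits {v : V // v ∉ S}) :
    ((partialTrace S (ρ.1 - ρ'.1)) a a).re
      = (∑ z, if forget S z = a then born ρ z else 0)
        - ∑ z, if forget S z = a then born ρ' z else 0 := by
  simp only [partialTrace, Matrix.of_apply, Complex.re_sum]
  rw [← sum_glue, ← sum_glue, ← Finset.sum_sub_distrib]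
  simp [born]

lemma hammingDist_le_forget (S : Finset V) (z w : Bits V) :
    hammingDist z w ≤ S.card + hammingDist (forget S z) (forget S w) := by
  unfold hammingDist
  have h1 : (Finset.univ.filter fun v => z v ≠ w v) ⊆ S ∪
      (Finset.univ.filter fun v : {v : V // v ∉ S} => forget S z v ≠ forget S w v).map
        (Function.Embedding.subtype _) := by
    intro v hv
    by_cases hS : v ∈ S
    · exact Finset.mem_union_left _ hS
    · refine Finset.mem_union_right _ ?_
      simp only [Finset.mem_filter, Finset.mem_univ, true_and] at hv
      exact Finset.mem_map.2 ⟨⟨v, hS⟩, Finset.mem_filter.2 ⟨Finset.mem_univ _, hv⟩, rfl⟩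
  refine (Finset.card_le_card h1).trans ((Finset.card_union_le _ _).trans ?_)
  rw [Finset.card_map]

/-- States that are close in the quantum Wasserstein distance after discarding the qubits in `S`
have measurement outcomes that can be coupled at a small Hamming distance. -/
lemma exists_coupling_of_wassersteinNorm_lt (ρ ρ' : MixedState V) (S : Finset V) {W s : ℝ}
    (hs : 0 ≤ s)
    (hW : wassersteinNorm 2 (partialTrace S (ρ.1 - ρ'.1)) < ENNReal.ofReal W) :
    ∃ π, IsCoupling (born ρ) (born ρ') π ∧
      (∑ a, ∑ b, if (S.card : ℝ) + s < (hammingDist a b : ℝ) then π a b else 0) * s ^ 2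
        ≤ W ^ 2 := by
  classical
  obtain ⟨Y, hYW⟩ := iInf_lt_iff.1 hW
  obtain ⟨hY, hlt⟩ := iInf_lt_iff.1 hYW
  obtain ⟨hlt, hWpos⟩ := ENNReal.ofReal_lt_ofReal_iff'.1 hlt
  have hsumnn : ∀ (ρ : MixedState V) (a : Bits {v : V // v ∉ S}),
      0 ≤ ∑ z, if forget S z = a then born ρ z else 0 := fun ρ a =>
    Finset.sum_nonneg fun z _ => by split_ifs <;> simp [born_nonneg]
  obtain ⟨κ, hκ, hc⟩ := exists_coupling_of_decomp (hsumnn ρ) (hsumnn ρ')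
    (re_partialTrace_diag S ρ ρ') hY
  obtain ⟨π, hπ, hF⟩ := IsCoupling.lift (forget S) (born_nonneg ρ) (born_nonneg ρ') hκ
  refine ⟨π, hπ, ?_⟩
  have htail := tail_mul_sq_le hκ hc hs
  -- The discarded qubits contribute at most `S.card` to the Hamming distance, so a large distance
  -- of the full strings forces distance above `s` between the remaining ones.
  have h1 : (∑ a, ∑ b, if (S.card : ℝ) + s < (hammingDist a b : ℝ) then π a b else 0)
      ≤ ∑ a, ∑ b, if s < (hammingDist a b : ℝ) then κ a b else 0 := by
    have := hF fun b b' => if s < (hammingDist b b' : ℝ) then 1 else 0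
    simp only [mul_ite, mul_one, mul_zero] at this
    rw [← this]
    refine Finset.sum_le_sum fun a _ => Finset.sum_le_sum fun b _ => ?_
    have hd : (hammingDist a b : ℝ)
        ≤ S.card + hammingDist (forget S a) (forget S b) := by
      exact_mod_cast hammingDist_le_forget S a b
    have hn := hπ.nonneg a b
    split_ifs with h3 h4 h4
    · exact le_rfl
    · exact absurd (by linarith) h4
    · exact hn
    · exact le_rfl
  have h2 : ∑ i, Real.sqrt (traceNorm ((1 / 2 : ℂ) • Y i)) < W := by
    simpa only [Real.sqrt_eq_rpow] using hlt
  calc _ ≤ (∑ a, ∑ b, if s < (hammingDist a b : ℝ) then κ a b else 0) * s ^ 2 :=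
        mul_le_mul_of_nonneg_right h1 (sq_nonneg s)
    _ ≤ _ := htail
    _ ≤ W ^ 2 := pow_le_pow_left₀ (Finset.sum_nonneg fun i _ => Real.sqrt_nonneg _) h2.le 2

end Quantum

/-! ### Paths through random sets -/

section Paths

variable {Z : Type} [Fintype Z]

/-- There is a path of `n` steps from `z`, with consecutive points related by `D` and the `t`-th
point in `O t`. -/
def HasPath (D : Z → Z → Prop) (n : ℕ) (O : ℕ → Set Z) (z : Z) : Prop :=
  ∃ x : ℕ → Z, x 0 = z ∧ (∀ t ≤ n, x t ∈ O t) ∧ ∀ t < n, D (x t) (x (t + 1))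

omit [Fintype Z] in
lemma HasPath.cons {D : Z → Z → Prop} {n : ℕ} {O : ℕ → Set Z} {z z' : Z} (hz : z ∈ O 0)
    (hD : D z z') (h : HasPath D n (fun t => O (t + 1)) z') : HasPath D (n + 1) O z := by
  obtain ⟨x, h0, hO, hx⟩ := h
  refine ⟨fun t => Nat.casesOn t z x, rfl, fun t ht => ?_, fun t ht => ?_⟩
  · cases t with
    | zero => exact hz
    | succ t => exact hO t (by omega)
  · cases t with
    | zero => simpa [h0] using hD
    | succ t => exact hx t (by omega)

-- Couple consecutive distributions one step at a time: a path can fail only because a point misses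
-- its set or because a coupled step is not `D`-related. Asking only for existence of a path means
-- that the couplings need not be composed into one joint law. A step without a useful coupling is
-- charged `1`, which makes the bound trivial.
open Classical in
lemma sum_not_hasPath_le (D : Z → Z → Prop) (n : ℕ) (O : ℕ → Set Z) (p : ℕ → Z → ℝ) (τ : ℕ → ℝ)
    (hp : ∀ t z, 0 ≤ p t z) (hp1 : ∀ t, ∑ z, p t z ≤ 1) (hτ : ∀ t, 0 ≤ τ t)
    (H : ∀ t < n, 1 ≤ τ t ∨ ∃ π, IsCoupling (p t) (p (t + 1)) π ∧
      (∑ a, ∑ b, if ¬ D a b then π a b else 0) ≤ τ t) :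
    (∑ z, if ¬ HasPath D n O z then p 0 z else 0)
      ≤ ∑ t ∈ Finset.range (n + 1), (∑ z, if z ∉ O t then p t z else 0)
        + ∑ t ∈ Finset.range n, τ t := by
  induction n generalizing O p τ with
  | zero =>
    simp only [zero_add, Finset.range_one, Finset.sum_singleton, Finset.range_zero,
      Finset.sum_empty, add_zero]
    refine Finset.sum_le_sum fun z _ => ?_
    have := hp 0 z
    by_cases h2 : z ∈ O 0
    · have h1 : HasPath D 0 O z :=
        ⟨fun _ => z, rfl, fun t ht => by simpa [Nat.le_zero.1 ht] using h2, by simp⟩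
      simp [h1, h2]
    · simp only [h2, not_false_eq_true, if_true]
      split_ifs <;> linarith
  | succ n ih =>
    have ih' := ih (fun t => O (t + 1)) (fun t => p (t + 1)) (fun t => τ (t + 1))
      (fun t => hp _) (fun t => hp1 _) (fun t => hτ _) (fun t ht => H (t + 1) (by omega))
    rw [Finset.sum_range_succ' _ (n + 1), Finset.sum_range_succ' τ n]
    have hfail : ∀ t, 0 ≤ ∑ z, if z ∉ O t then p t z else 0 := fun t =>
      Finset.sum_nonneg fun z _ => by split_ifs <;> simp [hp]
    rcases H 0 (by omega) with h1 | ⟨π, hπ, hD⟩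
    · have h2 : (∑ z, if ¬ HasPath D (n + 1) O z then p 0 z else 0) ≤ 1 :=
        le_trans (Finset.sum_le_sum fun z _ => by
          have := hp 0 z
          split_ifs <;> linarith) (hp1 0)
      have h3 : 0 ≤ ∑ t ∈ Finset.range (n + 1), ∑ z, if z ∉ O (t + 1) then p (t + 1) z else 0 :=
        Finset.sum_nonneg fun t _ => hfail _
      have h4 : 0 ≤ ∑ t ∈ Finset.range n, τ (t + 1) := Finset.sum_nonneg fun t _ => hτ _
      have h5 := hfail 0
      linarith
    · have key : (∑ z, if ¬ HasPath D (n + 1) O z then p 0 z else 0)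
          ≤ (∑ z, if z ∉ O 0 then p 0 z else 0)
            + (∑ a, ∑ b, if ¬ D a b then π a b else 0)
            + ∑ b, if ¬ HasPath D n (fun t => O (t + 1)) b then p (0 + 1) b else 0 := by
        have e3 : (∑ b, if ¬ HasPath D n (fun t => O (t + 1)) b then p (0 + 1) b else 0)
            = ∑ a, ∑ b, if ¬ HasPath D n (fun t => O (t + 1)) b then π a b else 0 := by
          rw [Finset.sum_comm]
          refine Finset.sum_congr rfl fun b _ => ?_
          split_ifs
          · simp
          · exact (hπ.snd b).symm
        rw [e3, ← Finset.sum_add_distrib, ← Finset.sum_add_distrib]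
        refine Finset.sum_le_sum fun a _ => ?_
        rw [← hπ.fst a]
        have e1 : ∀ (P : Prop) [Decidable P], (if P then ∑ b, π a b else 0) = ∑ b, if P then π a b else 0 := by
          intro P _
          split_ifs <;> simp
        simp only [e1]
        rw [← Finset.sum_add_distrib, ← Finset.sum_add_distrib]
        refine Finset.sum_le_sum fun b _ => ?_
        have hn := hπ.nonneg a b
        by_cases c1 : a ∈ O 0
        · by_cases c2 : D a b
          · by_cases c3 : HasPath D n (fun t => O (t + 1)) b
            · have := HasPath.cons c1 c2 c3
              simp [this, c1, c2, c3]
            · simp only [c1, c2, c3, not_true, not_false_eq_true, if_true, if_false]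
              split_ifs <;> linarith
          · simp only [c1, c2, not_true, not_false_eq_true, if_true, if_false]
            split_ifs <;> linarith
        · simp only [c1, not_false_eq_true, if_true]
          split_ifs <;> linarith
      linarith

end Paths

/-! ### Ramsey's theorem for several colours -/

/-- Choose a point, keep the most popular colour class among the others, and recurse inside it. The
colour of a pair then depends only on its earlier point. -/
lemma exists_endColoured (γ : Type) [Fintype γ] [Nonempty γ] (N : ℕ) :
    ∃ T : ℕ, ∀ (α : Type) [DecidableEq α] (A : Finset α) (col : α → α → γ), T ≤ A.card →
      ∃ x : Fin N → α, Function.Injective x ∧ (∀ i, x i ∈ A) ∧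
        ∃ c : Fin N → γ, ∀ i j, i < j → col (x i) (x j) = c i := by
  classical
  induction N with
  | zero =>
    exact ⟨0, fun α _ A col _ => ⟨Fin.elim0, fun i => i.elim0, fun i => i.elim0, Fin.elim0,
      fun i => i.elim0⟩⟩
  | succ N ih =>
    obtain ⟨T, hT⟩ := ih
    refine ⟨Fintype.card γ * T + 1, fun α _ A col hA => ?_⟩
    obtain ⟨a, ha⟩ : A.Nonempty := Finset.card_pos.1 (by omega)
    have hcard : (Finset.univ : Finset γ).card * T ≤ (A.erase a).card := by
      rw [Finset.card_erase_of_mem ha, Finset.card_univ]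
      omega
    obtain ⟨c, -, hc⟩ := Finset.exists_le_card_fiber_of_mul_le_card_of_maps_to
      (f := col a) (fun b _ => Finset.mem_univ _) Finset.univ_nonempty hcard
    obtain ⟨x, hinj, hmem, cs, hcs⟩ := hT α _ col hc
    simp only [Finset.mem_filter, Finset.mem_erase] at hmem
    refine ⟨Fin.cons a x, Fin.cons_injective_iff.2 ⟨?_, hinj⟩, fun i => ?_, Fin.cons c cs,
      fun i j hij => ?_⟩
    · rintro ⟨i, hi⟩
      exact (hmem i).1.1 hi
    · refine Fin.cases ha (fun i => ?_) i
      exact (hmem i).1.2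
    · obtain ⟨j, rfl⟩ := Fin.exists_succ_eq.2 (Fin.ne_zero_of_lt hij)
      induction i using Fin.cases with
      | zero => simpa using (hmem j).2
      | succ i => simpa using hcs i j (by simpa using hij)

theorem exists_ramsey (γ : Type) [Fintype γ] [Nonempty γ] (R : ℕ) :
    ∃ T : ℕ, ∀ col : Fin T → Fin T → γ, ∃ ι : Fin R → Fin T, Function.Injective ι ∧
      ∃ c, ∀ i j, i < j → col (ι i) (ι j) = c := by
  classical
  -- Among this many points, pigeonhole on the colour of the earlier point leaves `R` with the same
  -- colour.
  obtain ⟨T, hT⟩ := exists_endColoured γ (Fintype.card γ * R)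
  refine ⟨T, fun col => ?_⟩
  obtain ⟨x, hinj, -, cs, hcs⟩ := hT (Fin T) Finset.univ col (by simp)
  obtain ⟨c, -, hc⟩ := Finset.exists_le_card_fiber_of_mul_le_card_of_maps_to
    (s := Finset.univ) (t := Finset.univ) (f := cs) (n := R)
    (fun b _ => Finset.mem_univ _) Finset.univ_nonempty (by simp)
  set e := Finset.orderEmbOfCardLe _ hc
  refine ⟨fun i => x (e i), hinj.comp e.injective, c, fun i j hij => ?_⟩
  rw [hcs _ _ (e.strictMono hij)]
  have := Finset.orderEmbOfCardLe_mem _ hc i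
  simpa using this

/-! ### Averages under the correlated ensemble -/

/-- The mean of a function on a finite type. -/
def mean {α : Type} [Fintype α] (p : PMF α) (h : α → ℝ) : ℝ := ∑ x, (p x).toReal * h x

section Mean

variable {α β : Type} [Fintype α] [Fintype β]

lemma mean_bind (p : PMF α) (f : α → PMF β) (h : β → ℝ) :
    mean (p.bind f) h = mean p fun a => mean (f a) h := by
  have h1 : ∀ b, (p.bind f b).toReal = ∑ a, (p a).toReal * (f a b).toReal := by
    intro b
    rw [PMF.bind_apply, tsum_fintype, ENNReal.toReal_sum]
    · simp only [ENNReal.toReal_mul]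
    · intro a _
      exact ENNReal.mul_ne_top (p.apply_ne_top a) ((f a).apply_ne_top b)
  simp only [mean, h1, Finset.sum_mul, Finset.mul_sum]
  rw [Finset.sum_comm]
  simp only [mul_assoc]

lemma mean_pure (a : α) (h : α → ℝ) : mean (PMF.pure a) h = h a := by
  classical
  unfold mean
  rw [Finset.sum_eq_single a]
  · simp [PMF.pure_apply]
  · intro b _ hb
    simp [PMF.pure_apply, hb]
  · simp

lemma mean_map (f : α → β) (p : PMF α) (h : β → ℝ) :
    mean (p.map f) h = mean p fun a => h (f a) := by
  rw [← PMF.bind_pure_comp, mean_bind]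
  simp only [Function.comp, mean_pure]

open Finset in
lemma mean_uniform [Nonempty α] (h : α → ℝ) :
    mean (PMF.uniformOfFintype α) h = 𝔼 a, h a := by
  rw [Fintype.expect_eq_sum_div_card, Finset.sum_div]
  refine Finset.sum_congr rfl fun a _ => ?_
  rw [PMF.uniformOfFintype_apply, ENNReal.toReal_inv, ENNReal.toReal_natCast]
  ring

lemma mean_mono (p : PMF α) {h h' : α → ℝ} (hh : ∀ a, h a ≤ h' a) : mean p h ≤ mean p h' :=
  Finset.sum_le_sum fun a _ => mul_le_mul_of_nonneg_left (hh a) ENNReal.toReal_nonneg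

lemma toReal_toOuterMeasure (p : PMF α) (s : Set α) :
    (p.toOuterMeasure s).toReal = mean p (s.indicator 1) := by
  classical
  rw [PMF.toOuterMeasure_apply_fintype, ENNReal.toReal_sum]
  · refine Finset.sum_congr rfl fun a _ => ?_
    by_cases ha : a ∈ s <;> simp [ha]
  · intro a _
    by_cases ha : a ∈ s <;> simp [ha, p.apply_ne_top a]

lemma mean_one (p : PMF α) : mean p (fun _ => 1) = 1 := by
  have h := p.tsum_coe
  rw [tsum_fintype] at h
  have h' := congrArg ENNReal.toReal h
  rw [ENNReal.toReal_sum fun a _ => p.apply_ne_top a] at h'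
  simpa [mean] using h'

end Mean

/-! ### Symmetries of the resampled parities -/

section Laws

open Finset

variable {k d l : ℕ}

/-- The parities of a set of clauses. -/
abbrev Par (d l : ℕ) : Type := Clause d l → ZMod 2

/-- The constraint matrix of a merge of layers. -/
def conMat (G : Fin k → Layer d l) : Matrix (Clause d l) (Var k l) (ZMod 2) :=
  (parityCheck G).transpose

lemma mean_conLaw (h : Matrix (Clause d l) (Var k l) (ZMod 2) → ℝ) :
    mean (conLaw k d l) h = 𝔼 G : Fin k → Layer d l, h (conMat G) := by
  rw [conLaw, gallager, mean_map, mean_map, mean_uniform]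
  rfl

lemma mean_instLaw (h : Inst k d l → ℝ) :
    mean (instLaw k d l) h = 𝔼 G, 𝔼 v, h (conMat G, v) := by
  simp only [instLaw, mean_bind, mean_pure, mean_conLaw, parLaw, mean_uniform]

lemma mean_corrLaw (R : ℕ) (κ : ℝ) (h : (Fin R → Inst k d l) → ℝ) :
    mean (corrLaw k d l R κ) h
      = 𝔼 G, 𝔼 v : Par d l, 𝔼 w : Fin R → Par d l, 𝔼 σ : Equiv.Perm (Clause d l),
        h fun r => (conMat G,
          if (r : ℕ) = 0 then v else resample σ ⌊κ * ((d * l : ℕ) : ℝ)⌋₊ v (w r)) := by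
  simp only [corrLaw, mean_bind, mean_pure, mean_conLaw, parLaw, mean_uniform]

lemma resample_apply (σ : Equiv.Perm (Clause d l)) (p : ℕ) (v w : Par d l) (i : Clause d l) :
    resample σ p v w i = if (σ i : ℕ) < p then w i else v i := by
  have h : ∀ x y : ZMod 2, x + (x + y) = y := by decide
  unfold resample
  split_ifs
  · exact h _ _
  · exact add_zero _

lemma resample_zero (σ : Equiv.Perm (Clause d l)) (v w : Par d l) : resample σ 0 v w = v := by
  funext i
  simp [resample_apply]

lemma expect_restrict {ι κ α : Type} [Fintype ι] [Fintype κ] [Fintype α] [Nonempty α]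
    [DecidableEq ι] [DecidableEq κ]
    {e : κ → ι} (he : Function.Injective e) (g : (κ → α) → ℝ) :
    𝔼 w : ι → α, g (fun j => w (e j)) = 𝔼 w : κ → α, g w := by
  classical
  let E : (ι → α) ≃ (κ → α) × ({i // i ∉ Set.range e} → α) :=
    (Equiv.piEquivPiSubtypeProd (fun i => i ∈ Set.range e) fun _ => α).trans
      (Equiv.prodCongr (Equiv.arrowCongr (Equiv.ofInjective e he).symm (Equiv.refl α))
        (Equiv.refl _))
  rw [Fintype.expect_equiv E (fun w => g fun j => w (e j)) (fun x => g x.1) (fun w => rfl)]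
  rw [← Finset.univ_product_univ, Finset.expect_product]
  simp

lemma expect_eval {ι α : Type} [Fintype ι] [Fintype α] [Nonempty α] [DecidableEq ι] (i : ι)
    (g : α → ℝ) : 𝔼 w : ι → α, g (w i) = 𝔼 a, g a := by
  rw [expect_restrict (e := fun _ : Unit => i) (fun _ _ _ => rfl) fun w => g (w ())]
  exact Fintype.expect_equiv (Equiv.funUnique Unit α) _ _ fun w => rfl

/-- Exchanging `v` and `w` on the first `p` clauses is an involution, so it preserves the uniform
law of the pair. -/
lemma expect_swap (σ : Equiv.Perm (Clause d l)) (p : ℕ) (F : Par d l → Par d l → ℝ) :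
    𝔼 v, 𝔼 w, F (resample σ p v w) (resample σ p w v) = 𝔼 v, 𝔼 w, F v w := by
  have hinv : Function.Involutive fun x : Par d l × Par d l =>
      (resample σ p x.1 x.2, resample σ p x.2 x.1) := by
    rintro ⟨v, w⟩
    ext i <;> simp only [resample_apply] <;> split_ifs <;> rfl
  rw [← Finset.expect_product', ← Finset.expect_product']
  exact Fintype.expect_equiv hinv.toPerm _ _ fun x => rfl

lemma expect_resample (σ : Equiv.Perm (Clause d l)) (p : ℕ) (F : Par d l → ℝ) :
    𝔼 v, 𝔼 w, F (resample σ p v w) = 𝔼 v, F v := by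
  rw [expect_swap σ p fun v _ => F v]
  simp

/-- In the ensemble one replica keeps the parities `v`, while here all `R` are resampled. The laws
agree because on the first `p` clauses `v` is itself uniform and independent of the fresh bits; the
involution exchanges `v` there with the vector of replica `0`. -/
lemma expect_resample_tuple {R : ℕ} (hR : 0 < R) (σ : Equiv.Perm (Clause d l)) (p : ℕ)
    (F : (Fin R → Par d l) → ℝ) :
    𝔼 v, 𝔼 w : Fin R → Par d l, F (fun r => resample σ p v (w r))
      = 𝔼 v, 𝔼 w : Fin R → Par d l,
        F (fun r => if (r : ℕ) = 0 then v else resample σ p v (w r)) := by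
  let o : Fin R := ⟨0, hR⟩
  have hinv : Function.Involutive fun x : Par d l × (Fin R → Par d l) =>
      (resample σ p x.1 (x.2 o), Function.update x.2 o (resample σ p (x.2 o) x.1)) := by
    rintro ⟨v, w⟩
    refine Prod.ext ?_ ?_
    · funext i
      simp only [Function.update_self, resample_apply]
      split_ifs <;> rfl
    · funext r i
      by_cases hr : r = o
      · subst hr
        simp only [Function.update_self, resample_apply]
        split_ifs <;> rfl
      · simp [hr]
  rw [← Finset.expect_product', ← Finset.expect_product']
  refine Fintype.expect_equiv hinv.toPerm _ _ fun x => ?_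
  congr 1
  funext r
  change resample σ p x.1 (x.2 r) = if (r : ℕ) = 0 then resample σ p x.1 (x.2 o) else
    resample σ p (resample σ p x.1 (x.2 o))
      (Function.update x.2 o (resample σ p (x.2 o) x.1) r)
  by_cases hr : r = o
  · rw [if_pos (by simp [hr, o]), hr]
  · rw [if_neg fun h => hr (Fin.ext h), Function.update_of_ne hr]
    funext i
    simp only [resample_apply]
    split_ifs <;> rfl

lemma exists_perm_shift {m p q : ℕ} (hpq : p ≤ q) (hq : q ≤ m) :
    ∃ ρ : Equiv.Perm (Fin m), ∀ x, (ρ x : ℕ) < q - p ↔ p ≤ (x : ℕ) ∧ (x : ℕ) < q := by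
  let e : {x : Fin m // p ≤ (x : ℕ) ∧ (x : ℕ) < q} ≃ {x : Fin m // (x : ℕ) < q - p} :=
    { toFun := fun x => ⟨⟨x.1 - p, by omega⟩, by have := x.2; simp only; omega⟩
      invFun := fun x => ⟨⟨x.1 + p, by have := x.2; omega⟩, by have := x.2; simp only; omega⟩
      left_inv := fun x => by
        have := x.2
        ext
        simp only
        omega
      right_inv := fun x => by
        ext
        simp }
  refine ⟨e.extendSubtype, fun x => ⟨fun h => ?_, fun h => e.extendSubtype_mem x h⟩⟩
  by_contra hx
  exact e.extendSubtype_not_mem x hx h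

/-- Two times of one chain differ only on clauses with positions in `[p, q)`. A swap makes the
earlier instance the base, and composing the uniform order with a permutation that moves these
positions to the front turns the later one into a resampling of `q - p` clauses. -/
lemma expect_resample_pair {p q : ℕ} (hpq : p ≤ q) (hq : q ≤ d * l)
    (F : Par d l → Par d l → ℝ) :
    𝔼 σ, 𝔼 v, 𝔼 w, F (resample σ p v w) (resample σ q v w)
      = 𝔼 σ, 𝔼 v, 𝔼 w, F v (resample σ (q - p) v w) := by
  obtain ⟨ρ, hρ⟩ := exists_perm_shift hpq hq
  refine Fintype.expect_equiv (Equiv.mulLeft ρ) _ _ fun σ => ?_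
  rw [← expect_swap σ p fun v w => F v (resample (Equiv.mulLeft ρ σ) (q - p) v w)]
  refine Finset.expect_congr rfl fun v _ => Finset.expect_congr rfl fun w _ => ?_
  congr 1
  funext i
  simp only [resample_apply, Equiv.coe_mulLeft, Equiv.Perm.mul_apply, hρ]
  split_ifs <;> first | rfl | omega

lemma expect_tuple_eq_mean_corrLaw {R T : ℕ} (hR : 0 < R) {ι : Fin R → Fin T}
    (hι : Function.Injective ι) (κ : ℝ) (h : (Fin R → Inst k d l) → ℝ) :
    𝔼 G, 𝔼 σ : Equiv.Perm (Clause d l), 𝔼 v, 𝔼 w : Fin T → Par d l,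
        h (fun r => (conMat G, resample σ ⌊κ * ((d * l : ℕ) : ℝ)⌋₊ v (w (ι r))))
      = mean (corrLaw k d l R κ) h := by
  rw [mean_corrLaw]
  refine Finset.expect_congr rfl fun G _ => ?_
  have h1 : ∀ v : Par d l, (𝔼 w : Fin R → Par d l, 𝔼 σ : Equiv.Perm (Clause d l),
        h fun r => (conMat G,
          if (r : ℕ) = 0 then v else resample σ ⌊κ * ((d * l : ℕ) : ℝ)⌋₊ v (w r)))
      = 𝔼 σ : Equiv.Perm (Clause d l), 𝔼 w : Fin R → Par d l, h fun r => (conMat G,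
          if (r : ℕ) = 0 then v else resample σ ⌊κ * ((d * l : ℕ) : ℝ)⌋₊ v (w r)) :=
    fun v => Finset.expect_comm _ _ _
  simp only [h1]
  rw [Finset.expect_comm Finset.univ Finset.univ fun (v : Par d l) (σ : Equiv.Perm (Clause d l)) =>
    𝔼 w : Fin R → Par d l, h fun r => (conMat G,
          if (r : ℕ) = 0 then v else resample σ ⌊κ * ((d * l : ℕ) : ℝ)⌋₊ v (w r))]
  refine Finset.expect_congr rfl fun σ _ => ?_
  rw [← expect_resample_tuple hR σ _ fun u => h fun r => (conMat G, u r)]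
  refine Finset.expect_congr rfl fun v _ => ?_
  exact expect_restrict hι fun u : Fin R → Par d l =>
    h fun r => (conMat G, resample σ ⌊κ * ((d * l : ℕ) : ℝ)⌋₊ v (u r))

lemma expect_pair_eq_mean_corrLaw {p q : ℕ} (hpq : p ≤ q) (hq : q ≤ d * l) {κ : ℝ}
    (hκ : ⌊κ * ((d * l : ℕ) : ℝ)⌋₊ = q - p) (h : Inst k d l → Inst k d l → ℝ) :
    𝔼 G, 𝔼 σ : Equiv.Perm (Clause d l), 𝔼 v, 𝔼 w : Par d l,
        h (conMat G, resample σ p v w) (conMat G, resample σ q v w)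
      = mean (corrLaw k d l 2 κ) fun X => h (X 0) (X 1) := by
  rw [mean_corrLaw]
  refine Finset.expect_congr rfl fun G _ => ?_
  rw [expect_resample_pair hpq hq fun v v' => h (conMat G, v) (conMat G, v'), hκ]
  rw [Finset.expect_comm]
  refine Finset.expect_congr rfl fun v _ => ?_
  rw [Finset.expect_comm]
  exact (expect_eval (ι := Fin 2) 1 fun w : Par d l => 𝔼 σ : Equiv.Perm (Clause d l),
    h (conMat G, v) (conMat G, resample σ (q - p) v w)).symm

lemma expect_single_eq_mean_instLaw (p : ℕ) (h : Inst k d l → ℝ) :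
    𝔼 G, 𝔼 σ : Equiv.Perm (Clause d l), 𝔼 v, 𝔼 w : Par d l, h (conMat G, resample σ p v w)
      = mean (instLaw k d l) h := by
  rw [mean_instLaw]
  refine Finset.expect_congr rfl fun G _ => ?_
  simp only [expect_resample _ p fun v => h (conMat G, v)]
  simp

lemma hammingDist_resample_le {p q : ℕ} (hpq : p ≤ q) (hq : q ≤ d * l)
    (σ : Equiv.Perm (Clause d l)) (v w : Par d l) :
    hammingDist (resample σ p v w) (resample σ q v w) ≤ q - p := by
  obtain ⟨ρ, hρ⟩ := exists_perm_shift hpq hq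
  have h : (Finset.univ.filter fun i => resample σ p v w i ≠ resample σ q v w i).card
      ≤ (Finset.range (q - p)).card := by
    refine Finset.card_le_card_of_injOn (fun i => ((ρ (σ i) : Fin (d * l)) : ℕ)) ?_ ?_
    · intro i hi
      simp only [Finset.coe_filter, Finset.mem_univ, true_and, resample_apply] at hi
      simp only [Finset.coe_range, Set.mem_Iio, hρ]
      by_contra hcon
      refine hi ?_
      split_ifs <;> first | rfl | omega
    · intro i _ j _ hij
      exact σ.injective (ρ.injective (Fin.ext hij))
  simpa [hammingDist] using h

end Laws

/-! ### Conditionally independent replicas -/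

section Averaging

open Finset

open Classical in
/-- Jensen's inequality for replicas that are conditionally independent given `(ξ, z)`. -/
lemma pow_le_expect_replicas {Ξ Z W : Type} [Fintype Ξ] [Nonempty Ξ] [Fintype Z] [Fintype W]
    (P : Ξ → Z → ℝ) (hP : ∀ ξ z, 0 ≤ P ξ z) (hP1 : ∀ ξ, ∑ z, P ξ z = 1)
    (A : Ξ → Z → W → Prop) {c : ℝ} (hc : 0 ≤ c)
    (h : c ≤ 𝔼 ξ, ∑ z, P ξ z * 𝔼 w, if A ξ z w then (1 : ℝ) else 0) (T : ℕ) :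
    c ^ T ≤ 𝔼 ξ, 𝔼 w : Fin T → W, if ∃ z, ∀ r, A ξ z (w r) then (1 : ℝ) else 0 := by
  set a : Ξ → Z → ℝ := fun ξ z => 𝔼 w, if A ξ z w then (1 : ℝ) else 0 with ha
  have ha0 : ∀ ξ z, 0 ≤ a ξ z := fun ξ z =>
    Finset.expect_nonneg fun w _ => by split_ifs <;> norm_num
  have hN : (0 : ℝ) < Fintype.card Ξ := by exact_mod_cast Fintype.card_pos
  have hexp : ∀ b : Ξ → Z → ℝ, 𝔼 ξ, ∑ z, P ξ z * b ξ z
      = ∑ x : Ξ × Z, (P x.1 x.2 / Fintype.card Ξ) * b x.1 x.2 := by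
    intro b
    rw [Fintype.expect_eq_sum_div_card, Fintype.sum_prod_type, Finset.sum_div]
    refine Finset.sum_congr rfl fun ξ _ => ?_
    rw [Finset.sum_div]
    exact Finset.sum_congr rfl fun z _ => by ring
  have hw1 : ∑ x : Ξ × Z, P x.1 x.2 / Fintype.card Ξ = 1 := by
    have := hexp fun _ _ => 1
    simp only [mul_one, hP1] at this
    rw [← this]
    simp
  -- For fixed `(ξ, z)` independence makes the power the probability that all replicas succeed with
  -- this very `z`.
  have hpow : ∀ ξ z, a ξ z ^ T
      ≤ 𝔼 w : Fin T → W, if ∃ z, ∀ r, A ξ z (w r) then (1 : ℝ) else 0 := by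
    intro ξ z
    rw [ha]
    simp only
    rw [Finset.expect_pow, Fintype.piFinset_univ]
    refine Finset.expect_le_expect fun w _ => ?_
    rw [Finset.prod_ite_zero]
    simp only [Finset.mem_univ, true_implies, Finset.prod_const_one]
    split_ifs with h1 h2 h2
    · exact le_rfl
    · exact absurd ⟨z, h1⟩ h2
    · exact zero_le_one
    · exact le_rfl
  calc c ^ T ≤ (𝔼 ξ, ∑ z, P ξ z * a ξ z) ^ T := pow_le_pow_left₀ hc h T
    _ = (∑ x : Ξ × Z, (P x.1 x.2 / Fintype.card Ξ) * a x.1 x.2) ^ T := by rw [hexp]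
    _ ≤ ∑ x : Ξ × Z, (P x.1 x.2 / Fintype.card Ξ) * a x.1 x.2 ^ T :=
        Real.pow_arith_mean_le_arith_mean_pow _ _ _
          (fun x _ => div_nonneg (hP _ _) hN.le) hw1 (fun x _ => ha0 _ _) T
    _ = 𝔼 ξ, ∑ z, P ξ z * a ξ z ^ T := (hexp fun ξ z => a ξ z ^ T).symm
    _ ≤ _ := by
      refine Finset.expect_le_expect fun ξ _ => ?_
      calc ∑ z, P ξ z * a ξ z ^ T ≤ ∑ z, P ξ z *
            𝔼 w : Fin T → W, (if ∃ z, ∀ r, A ξ z (w r) then (1 : ℝ) else 0) :=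
            Finset.sum_le_sum fun z _ => mul_le_mul_of_nonneg_left (hpow ξ z) (hP ξ z)
        _ = _ := by rw [← Finset.sum_mul, hP1, one_mul]

end Averaging

/-! ### Stability of the blockwise distance -/

section MinHamming

variable {k l : ℕ}

lemma minHamming_comm (a b : Bits (Var k l)) : minHamming a b = minHamming b a := by
  simp only [minHamming, hammingDist_comm]

lemma sum_hammingDist_block (a b : Bits (Var k l)) :
    ∑ i : Fin k, hammingDist (fun c => a (i, c)) (fun c => b (i, c)) = hammingDist a b := by
  simp only [hammingDist, Finset.card_filter, Fintype.sum_prod_type]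

/-- On each block `min w (l - w)` is 1-Lipschitz in `w`, and `w` obeys the triangle inequality. -/
lemma minHamming_le_add (a b a' b' : Bits (Var k l)) :
    minHamming a b ≤ minHamming a' b' + (hammingDist a a' + hammingDist b b') := by
  rw [← sum_hammingDist_block a a', ← sum_hammingDist_block b b', ← Finset.sum_add_distrib]
  unfold minHamming
  rw [← Finset.sum_add_distrib]
  refine Finset.sum_le_sum fun i _ => ?_
  set x := fun c => a (i, c)
  set y := fun c => b (i, c)
  set x' := fun c => a' (i, c)
  set y' := fun c => b' (i, c)
  have h1 : hammingDist x y ≤ l := by simpa using hammingDist_le_card_fintype (x := x) (y := y)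
  have h2 : hammingDist x' y' ≤ l := by
    simpa using hammingDist_le_card_fintype (x := x') (y := y')
  have h3 := hammingDist_triangle x x' y
  have h4 := hammingDist_triangle x' y' y
  have h5 := hammingDist_triangle x' x y'
  have h6 := hammingDist_triangle x y y'
  rw [hammingDist_comm y' y] at h4
  rw [hammingDist_comm x' x] at h5
  omega

lemma minHamming_self (a : Bits (Var k l)) : minHamming a a = 0 := by
  simp [minHamming]

end MinHamming

/-! ### Fixing the randomness of the algorithm -/

section Randomness

variable {k d l : ℕ} {Ω : Type*} [MeasurableSpace Ω]

open Classical in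
/-- The probability of measuring an outcome outside `E`. -/
def failProb {V : Type} [Fintype V] [DecidableEq V] (ρ : MixedState V) (E : Set (Bits V)) : ℝ :=
  ∑ z, if z ∉ E then born ρ z else 0

lemma failProb_eq {V : Type} [Fintype V] [DecidableEq V] (ρ : MixedState V)
    (E : Set (Bits V)) : failProb ρ E = 1 - measureProb ρ E := by
  classical
  rw [← sum_born ρ, failProb, measureProb, ← Finset.sum_sub_distrib]
  refine Finset.sum_congr rfl fun z _ => ?_
  by_cases hz : z ∈ E <;> simp [hz, born]

lemma failProb_mono {V : Type} [Fintype V] [DecidableEq V] (ρ : MixedState V)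
    {E E' : Set (Bits V)} (h : E ⊆ E') : failProb ρ E' ≤ failProb ρ E := by
  refine Finset.sum_le_sum fun z _ => ?_
  have := born_nonneg ρ z
  by_cases hz : z ∈ E
  · simp [hz, h hz]
  · simp only [hz, not_false_eq_true, if_true]
    split_ifs <;> linarith

lemma integrable_failProb (P : Measure Ω) [IsProbabilityMeasure P] (A : QAlg k d l Ω)
    (X : Inst k d l) (E : Set (Bits (Var k l))) :
    Integrable (fun ω => failProb (A.state X ω) E) P := by
  classical
  unfold failProb
  refine integrable_finsetSum _ fun z _ => ?_
  split_ifs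
  · exact integrable_zero _ _ _
  · refine Integrable.of_bound
      (Complex.measurable_re.comp (A.measurable_state X z z)).aestronglyMeasurable 1 ?_
    refine Filter.Eventually.of_forall fun ω => ?_
    change ‖born (A.state X ω) z‖ ≤ 1
    rw [Real.norm_of_nonneg (born_nonneg _ _), ← sum_born (A.state X ω)]
    exact Finset.single_le_sum (fun z _ => born_nonneg _ z) (Finset.mem_univ z)

open Classical in
/-- A good sample: for it, the failure probabilities are at most their averages. -/
lemma exists_sample (P : Measure Ω) [IsProbabilityMeasure P] (A : QAlg k d l Ω) {f : ℕ} {L : ℝ≥0}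
    {pst γ pf : ℝ} (hst : IsStable P A f L pst) (hopt : IsOptimal P A γ pf) (Q : ℕ) (κ : ℕ → ℝ)
    (hκ : ∀ t < Q, κ t ∈ Set.Icc (0 : ℝ) 1) :
    ∃ ω, ((Q : ℝ) + 1) * mean (instLaw k d l) (fun X => failProb (A.state X ω)
          {z | γ * density k d * numVar k l ≤ satCount X z})
        + ∑ t ∈ Finset.range Q, mean (corrLaw k d l 2 (κ t))
          (fun X => if StableAt A f L (X 0) (X 1) ω then 0 else 1)
      ≤ (Q + 1) * pf + Q * pst := by
  set F : Ω → ℝ := fun ω => mean (instLaw k d l) (fun X => failProb (A.state X ω)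
    {z | γ * density k d * numVar k l ≤ satCount X z}) with hF
  -- The unstable event need not be measurable; its measurable hull has the same measure and can be
  -- integrated.
  set U : (Fin 2 → Inst k d l) → Set Ω := fun X =>
    toMeasurable P {ω | ¬ StableAt A f L (X 0) (X 1) ω} with hU
  set H : ℕ → Ω → ℝ := fun t ω => mean (corrLaw k d l 2 (κ t))
    (fun X => (U X).indicator 1 ω) with hH
  have hindint : ∀ X, Integrable (fun ω => (U X).indicator (1 : Ω → ℝ) ω) P := fun X =>
    (integrable_const (1 : ℝ)).indicator (measurableSet_toMeasurable _ _)
  have hFint : Integrable F P :=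
    integrable_finsetSum _ fun X _ => (integrable_failProb P A X _).const_mul _
  have hHint : ∀ t, Integrable (H t) P := fun t =>
    integrable_finsetSum _ fun X _ => (hindint X).const_mul _
  have hFle : ∫ ω, F ω ∂P ≤ pf := by
    have h1 : ∫ ω, F ω ∂P = ∑ X, (instLaw k d l X).toReal * ∫ ω, failProb (A.state X ω)
        {z | γ * density k d * numVar k l ≤ satCount X z} ∂P := by
      simp only [hF, mean]
      rw [integral_finsetSum _ fun X _ => (integrable_failProb P A X _).const_mul _]
      simp only [integral_const_mul]
    have h2 : ∀ X : Inst k d l, ∫ ω, failProb (A.state X ω)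
          {z | γ * density k d * numVar k l ≤ satCount X z} ∂P
        = 1 - ∫ ω, measureProb (A.state X ω)
          {z | γ * density k d * numVar k l ≤ satCount X z} ∂P := by
      intro X
      have hi : Integrable (fun ω => measureProb (A.state X ω)
          {z | γ * density k d * numVar k l ≤ satCount X z}) P := by
        have := (integrable_const (μ := P) (1 : ℝ)).sub (integrable_failProb P A X
          {z | γ * density k d * numVar k l ≤ satCount X z})
        refine this.congr (Filter.Eventually.of_forall fun ω => ?_)
        simp [failProb_eq]
      simp only [failProb_eq]
      rw [integral_sub (integrable_const _) hi]
      simp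
    have h3 := mean_one (instLaw k d l)
    have h4 := hopt
    unfold IsOptimal at h4
    simp only [mean, mul_one] at h3
    rw [h1]
    simp only [h2, mul_sub, Finset.sum_sub_distrib, mul_one, h3]
    linarith
  have hHle : ∀ t < Q, ∫ ω, H t ω ∂P ≤ pst := by
    intro t ht
    have h1 : ∫ ω, H t ω ∂P = ∑ X : Fin 2 → Inst k d l, (corrLaw k d l 2 (κ t) X).toReal *
        P.real {ω | ¬ StableAt A f L (X 0) (X 1) ω} := by
      simp only [hH, mean]
      rw [integral_finsetSum _ fun X _ => (hindint X).const_mul _]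
      refine Finset.sum_congr rfl fun X _ => ?_
      rw [integral_const_mul, integral_indicator_one (measurableSet_toMeasurable _ _)]
      rw [measureReal_def, measure_toMeasurable, ← measureReal_def]
    rw [h1]
    exact hst (κ t) (hκ t ht)
  have hsumint : Integrable (fun ω => ∑ t ∈ Finset.range Q, H t ω) P :=
    integrable_finsetSum _ fun t _ => hHint t
  obtain ⟨ω, hω⟩ := exists_le_integral ((hFint.const_mul ((Q : ℝ) + 1)).add hsumint)
  refine ⟨ω, le_trans ?_ (hω.trans ?_)⟩
  · change _ ≤ ((Q : ℝ) + 1) * F ω + ∑ t ∈ Finset.range Q, H t ω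
    refine add_le_add le_rfl (Finset.sum_le_sum fun t _ => mean_mono _ fun X => ?_)
    have hsub : {ω | ¬ StableAt A f L (X 0) (X 1) ω} ⊆ U X := subset_toMeasurable _ _
    split_ifs with h
    · exact Set.indicator_nonneg (fun _ _ => zero_le_one) _
    · rw [Set.indicator_of_mem (hsub h)]
      rfl
  · have : ∫ ω, (((Q : ℝ) + 1) * F ω + ∑ t ∈ Finset.range Q, H t ω) ∂P
        = (Q + 1) * ∫ ω, F ω ∂P + ∑ t ∈ Finset.range Q, ∫ ω, H t ω ∂P := by
      rw [integral_add (hFint.const_mul _) hsumint, integral_const_mul,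
        integral_finsetSum _ fun t _ => hHint t]
    refine le_of_eq_of_le this (add_le_add ?_ ?_)
    · exact mul_le_mul_of_nonneg_left hFle (by positivity)
    · refine (Finset.sum_le_sum fun t ht => hHle t (Finset.mem_range.1 ht)).trans ?_
      simp

end Randomness

/-! ### Chains of correlated instances and their replicas -/

section Replicas

open Finset

variable {k d l : ℕ} {Ω : Type*} [MeasurableSpace Ω]

/-- Two strings at Hamming distance at most `f + s`. -/
def Near {V : Type} [Fintype V] [DecidableEq V] (f : ℕ) (s : ℝ) (a b : Bits V) : Prop :=
  (hammingDist a b : ℝ) ≤ f + s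

open Classical in
lemma exists_coupling_of_stableAt (A : QAlg k d l Ω) {f : ℕ} {L : ℝ≥0} {X X' : Inst k d l} {ω : Ω}
    (h : StableAt A f L X X' ω) {W s τ : ℝ} (hW : L * (hammingDist X.2 X'.2 : ℝ) < W)
    (hs : 0 < s) (hτ : W ^ 2 ≤ τ * s ^ 2) :
    ∃ π, IsCoupling (born (A.state X ω)) (born (A.state X' ω)) π ∧
      (∑ a, ∑ b, if ¬ Near f s a b then π a b else 0) ≤ τ := by
  obtain ⟨S, rfl, hS⟩ := h
  have hlt : wassersteinNorm 2 (partialTrace S ((A.state X ω).1 - (A.state X' ω).1))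
      < ENNReal.ofReal W := by
    refine lt_of_le_of_lt hS ?_
    have h1 : (L : ℝ≥0∞) * (hammingDist X.2 X'.2 : ℝ≥0∞)
        = ENNReal.ofReal (L * (hammingDist X.2 X'.2 : ℝ)) := by
      rw [ENNReal.ofReal_mul L.coe_nonneg, ENNReal.ofReal_coe_nnreal, ENNReal.ofReal_natCast]
    rw [h1]
    have h0 : (0 : ℝ) ≤ L * (hammingDist X.2 X'.2 : ℝ) := mul_nonneg L.coe_nonneg (Nat.cast_nonneg _)
    exact (ENNReal.ofReal_lt_ofReal_iff (lt_of_le_of_lt h0 hW)).2 hW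
  obtain ⟨π, hπ, ht⟩ := exists_coupling_of_wassersteinNorm_lt _ _ S hs.le hlt
  refine ⟨π, hπ, ?_⟩
  have h2 : (∑ a, ∑ b, if ¬ Near S.card s a b then π a b else 0)
      = ∑ a, ∑ b, if (S.card : ℝ) + s < (hammingDist a b : ℝ) then π a b else 0 := by
    refine Finset.sum_congr rfl fun a _ => Finset.sum_congr rfl fun b _ => ?_
    simp only [Near, not_le]
  rw [h2]
  exact le_of_mul_le_mul_right (ht.trans hτ) (by positivity)

-- Each stable step fails with probability at most `τ`; an unstable one has no coupling and is
-- charged `τ + 1`.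
open Classical in
lemma sum_not_hasPath_inst_le (A : QAlg k d l Ω) (f : ℕ) {L : ℝ≥0} (ω : Ω) {W s τ : ℝ}
    (hs : 0 < s) (hτ0 : 0 ≤ τ) (hτ : W ^ 2 ≤ τ * s ^ 2) (Q : ℕ)
    (O : Inst k d l → Set (Bits (Var k l))) (X : ℕ → Inst k d l)
    (hX : ∀ t < Q, L * (hammingDist (X t).2 (X (t + 1)).2 : ℝ) < W) :
    (∑ z, if ¬ HasPath (Near f s) Q (fun t => O (X t)) z then born (A.state (X 0) ω) z else 0)
      ≤ ∑ t ∈ Finset.range (Q + 1), failProb (A.state (X t) ω) (O (X t))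
        + ∑ t ∈ Finset.range Q, (τ + if StableAt A f L (X t) (X (t + 1)) ω then 0 else 1) := by
  refine sum_not_hasPath_le (Near f s) Q (fun t => O (X t)) (fun t => born (A.state (X t) ω)) _
    (fun t z => born_nonneg _ z) (fun t => (sum_born _).le)
    (fun t => by split_ifs <;> linarith) fun t ht => ?_
  by_cases h : StableAt A f L (X t) (X (t + 1)) ω
  · right
    rw [if_pos h, add_zero]
    exact exists_coupling_of_stableAt A h (hX t ht) hs hτ
  · left
    rw [if_neg h]
    linarith

lemma expect_triple {α β γ : Type} [Fintype α] [Fintype β] [Fintype γ] (F : α × β × γ → ℝ) :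
    𝔼 x, F x = 𝔼 a, 𝔼 b, 𝔼 c, F (a, b, c) := by
  rw [← Finset.univ_product_univ, Finset.expect_product]
  refine Finset.expect_congr rfl fun a _ => ?_
  rw [← Finset.univ_product_univ, Finset.expect_product]

open Classical in
/-- With constant probability, `T` conditionally independent replicas of the chain of correlated
instances have paths of near-optimal strings with a common start. -/
lemma pow_le_expect_hasPath (A : QAlg k d l Ω) (f : ℕ) {L : ℝ≥0} (ω : Ω) {W s τ : ℝ}
    (hs : 0 < s) (hτ0 : 0 ≤ τ) (hτ : W ^ 2 ≤ τ * s ^ 2) (Q : ℕ) (p : ℕ → ℕ) (hp0 : p 0 = 0)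
    (hmono : ∀ t < Q, p t ≤ p (t + 1)) (hle : ∀ t ≤ Q, p t ≤ d * l)
    (hW : ∀ t < Q, L * ((p (t + 1) - p t : ℕ) : ℝ) < W) (κ : ℕ → ℝ)
    (hκ : ∀ t < Q, ⌊κ t * ((d * l : ℕ) : ℝ)⌋₊ = p (t + 1) - p t)
    (O : Inst k d l → Set (Bits (Var k l))) {b : ℝ}
    (hb : ((Q : ℝ) + 1) * mean (instLaw k d l) (fun X => failProb (A.state X ω) (O X))
        + ∑ t ∈ Finset.range Q, mean (corrLaw k d l 2 (κ t))
          (fun X => if StableAt A f L (X 0) (X 1) ω then 0 else 1) ≤ b)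
    (hb1 : b + Q * τ ≤ 1) (T : ℕ) :
    (1 - (b + Q * τ)) ^ T ≤ 𝔼 G : Fin k → Layer d l, 𝔼 σ : Equiv.Perm (Clause d l),
      𝔼 v : Par d l, 𝔼 w : Fin T → Par d l, if ∃ z, ∀ r, HasPath (Near f s) Q
        (fun t => O (conMat G, resample σ (p t) v (w r))) z then (1 : ℝ) else 0 := by
  set ev : ((Fin k → Layer d l) × Equiv.Perm (Clause d l) × Par d l) → Bits (Var k l) →
      Par d l → Prop := fun ξ z w => HasPath (Near f s) Q
        (fun t => O (conMat ξ.1, resample ξ.2.1 (p t) ξ.2.2 w)) z with hev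
  have key := pow_le_expect_replicas (Ξ := (Fin k → Layer d l) × Equiv.Perm (Clause d l) × Par d l)
    (Z := Bits (Var k l)) (W := Par d l)
    (fun ξ z => born (A.state (conMat ξ.1, ξ.2.2) ω) z) (fun ξ z => born_nonneg _ z)
    (fun ξ => sum_born _) ev (c := 1 - (b + Q * τ)) (by linarith) ?_ T
  · rw [expect_triple] at key
    exact key
  rw [expect_triple]
  have hpt : ∀ (G : Fin k → Layer d l) (σ : Equiv.Perm (Clause d l)) (v : Par d l),
      𝔼 w : Par d l, (1 - (∑ t ∈ Finset.range (Q + 1),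
          failProb (A.state (conMat G, resample σ (p t) v w) ω)
            (O (conMat G, resample σ (p t) v w))
        + ∑ t ∈ Finset.range Q, (τ + if StableAt A f L (conMat G, resample σ (p t) v w)
            (conMat G, resample σ (p (t + 1)) v w) ω then 0 else 1)))
      ≤ ∑ z, born (A.state (conMat G, v) ω) z
          * 𝔼 w : Par d l, (if ev (G, σ, v) z w then (1 : ℝ) else 0) := by
    intro G σ v
    simp only [Finset.mul_expect]
    rw [← Finset.expect_sum_comm]
    refine Finset.expect_le_expect fun w _ => ?_
    have h1 := sum_not_hasPath_inst_le A f (L := L) ω hs hτ0 hτ Q O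
      (fun t => (conMat G, resample σ (p t) v w)) (fun t ht => lt_of_le_of_lt
        (mul_le_mul_of_nonneg_left (Nat.cast_le.2 (hammingDist_resample_le (hmono t ht)
          (hle (t + 1) ht) σ v w)) L.coe_nonneg) (hW t ht))
    simp only [hp0, resample_zero] at h1
    have h2 : ∑ z, born (A.state (conMat G, v) ω) z * (if ev (G, σ, v) z w then (1 : ℝ) else 0)
        = 1 - ∑ z, if ¬ HasPath (Near f s) Q
          (fun t => O (conMat G, resample σ (p t) v w)) z
            then born (A.state (conMat G, v) ω) z else 0 := by
      rw [eq_sub_iff_add_eq, ← Finset.sum_add_distrib]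
      refine (Finset.sum_congr rfl fun z _ => ?_).trans (sum_born (A.state (conMat G, v) ω))
      by_cases hz : HasPath (Near f s) Q (fun t => O (conMat G, resample σ (p t) v w)) z <;>
        simp [hev, hz]
    rw [h2]
    linarith
  refine le_trans ?_ (Finset.expect_le_expect fun G _ => Finset.expect_le_expect fun σ _ =>
    Finset.expect_le_expect fun v _ => hpt G σ v)
  simp only [Finset.expect_sub_distrib, Finset.expect_add_distrib, Finset.expect_sum_comm,
    Finset.sum_add_distrib]
  have e1 : ∀ t, (𝔼 G : Fin k → Layer d l, 𝔼 σ : Equiv.Perm (Clause d l), 𝔼 v : Par d l,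
      𝔼 w : Par d l, failProb (A.state (conMat G, resample σ (p t) v w) ω)
            (O (conMat G, resample σ (p t) v w)))
      = mean (instLaw k d l) (fun X => failProb (A.state X ω) (O X)) := fun t =>
    expect_single_eq_mean_instLaw (p t) fun X => failProb (A.state X ω) (O X)
  have e2 : ∀ t ∈ Finset.range Q, (𝔼 G : Fin k → Layer d l, 𝔼 σ : Equiv.Perm (Clause d l),
      𝔼 v : Par d l, 𝔼 w : Par d l, (if StableAt A f L (conMat G, resample σ (p t) v w)
            (conMat G, resample σ (p (t + 1)) v w) ω then (0 : ℝ) else 1))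
      = mean (corrLaw k d l 2 (κ t)) (fun X => if StableAt A f L (X 0) (X 1) ω then 0 else 1) := by
    intro t ht
    have ht' := Finset.mem_range.1 ht
    exact expect_pair_eq_mean_corrLaw (hmono t ht') (hle (t + 1) ht') (hκ t ht')
      fun X X' => if StableAt A f L X X' ω then 0 else 1
  simp only [e1]
  rw [Finset.sum_congr rfl e2]
  simp only [Finset.sum_const, Finset.card_range, nsmul_eq_mul, Fintype.expect_const]
  push_cast
  linarith

open Classical in
/-- Union bound over the `R`-tuples of replicas. -/
lemma expect_le_of_forall_exists_tuple {R T : ℕ} (hR : 0 < R) {γ : Type} [Fintype γ] (p : γ → ℕ)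
    (κ : γ → ℝ) (hκ : ∀ c, ⌊κ c * ((d * l : ℕ) : ℝ)⌋₊ = p c)
    (S : γ → Set (Fin R → Inst k d l)) {ε : ℝ}
    (hε : ∀ c, ((corrLaw k d l R (κ c)).toOuterMeasure (S c)).toReal ≤ ε)
    (E : (Fin k → Layer d l) → Equiv.Perm (Clause d l) → Par d l → (Fin T → Par d l) → Prop)
    (hE : ∀ G σ v w, E G σ v w → ∃ c : γ, ∃ ι : Fin R ↪ Fin T,
      (fun r => (conMat G, resample σ (p c) v (w (ι r)))) ∈ S c) :
    (𝔼 G : Fin k → Layer d l, 𝔼 σ : Equiv.Perm (Clause d l), 𝔼 v : Par d l,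
      𝔼 w : Fin T → Par d l, if E G σ v w then (1 : ℝ) else 0)
      ≤ Fintype.card γ * Nat.card (Fin R ↪ Fin T) * ε := by
  set g : γ → (Fin R → Inst k d l) → ℝ := fun c => (S c).indicator 1 with hg
  have hnn : ∀ c X, 0 ≤ g c X := fun c X => Set.indicator_nonneg (fun _ _ => zero_le_one) _
  have hpt : ∀ G σ v w, (if E G σ v w then (1 : ℝ) else 0) ≤ ∑ c : γ, ∑ ι : Fin R ↪ Fin T,
      g c (fun r => (conMat G, resample σ (p c) v (w (ι r)))) := by
    intro G σ v w
    split_ifs with h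
    · obtain ⟨c, ι, hc⟩ := hE G σ v w h
      refine le_trans ?_ (Finset.single_le_sum (fun c _ => Finset.sum_nonneg fun ι _ => hnn c _)
        (Finset.mem_univ c))
      refine le_trans ?_ (Finset.single_le_sum (fun ι _ => hnn c _) (Finset.mem_univ ι))
      simp only [hg]
      rw [Set.indicator_of_mem hc]
      exact le_rfl
    · exact Finset.sum_nonneg fun c _ => Finset.sum_nonneg fun ι _ => hnn c _
  refine (Finset.expect_le_expect fun G _ => Finset.expect_le_expect fun σ _ =>
    Finset.expect_le_expect fun v _ => Finset.expect_le_expect fun w _ => hpt G σ v w).trans ?_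
  have hterm : ∀ (c : γ) (ι : Fin R ↪ Fin T),
      (𝔼 G : Fin k → Layer d l, 𝔼 σ : Equiv.Perm (Clause d l), 𝔼 v : Par d l,
        𝔼 w : Fin T → Par d l, g c (fun r => (conMat G, resample σ (p c) v (w (ι r))))) ≤ ε := by
    intro c ι
    have h := expect_tuple_eq_mean_corrLaw (k := k) hR ι.injective (κ c) (g c)
    rw [hκ c] at h
    rw [h, hg, ← toReal_toOuterMeasure]
    exact hε c
  clear_value g
  simp only [Finset.expect_sum_comm]
  refine (Finset.sum_le_sum fun c _ => Finset.sum_le_sum fun ι _ => hterm c ι).trans ?_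
  simp only [Finset.sum_const, Finset.card_univ, nsmul_eq_mul, mul_assoc, Nat.card_eq_fintype_card]
  exact le_rfl

end Replicas

lemma OverlapBound.eventually_le {k d R : ℕ} {κ μ ν₁ ν₂ : ℝ} (hk : 1 ≤ k)
    (h : OverlapBound k d R κ μ ν₁ ν₂) {ε : ℝ} (hε : 0 < ε) :
    ∀ᶠ l : ℕ in atTop, ((corrLaw k d l R κ).toOuterMeasure
      {X | (overlapSet X μ ν₁ ν₂).Nonempty}).toReal ≤ ε := by
  obtain ⟨c, hc, hl⟩ := h
  have h1 : Tendsto (fun l : ℕ => numVar k l) atTop atTop := by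
    refine tendsto_natCast_atTop_atTop.comp ?_
    exact tendsto_id.const_mul_atTop' (by omega)
  have h2 : Tendsto (fun l : ℕ => Real.exp (-(c * numVar k l))) atTop (𝓝 0) :=
    Real.tendsto_exp_neg_atTop_nhds_zero.comp (h1.const_mul_atTop hc)
  filter_upwards [hl, h2.eventually (gt_mem_nhds hε)] with l hl1 hl2
  exact (ENNReal.toReal_le_of_le_ofReal (Real.exp_pos _).le hl1).trans hl2.le

/-! ### From paths to overlaps -/

section Obstruction

variable {k d l : ℕ} {Ω : Type*} [MeasurableSpace Ω]

/-- The strings that satisfy a fraction at least `μ` of the clauses of `X`. -/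
def nearOpt (μ : ℝ) (X : Inst k d l) : Set (Bits (Var k l)) :=
  {z | μ * density k d * numVar k l ≤ satCount X z}

lemma density_mul_numVar (hk : 1 ≤ k) : density k d * numVar k l = ((d * l : ℕ) : ℝ) := by
  have : (k : ℝ) ≠ 0 := by positivity
  unfold density numVar
  push_cast
  field_simp

lemma nearOpt_anti {μ γ : ℝ} (h : μ ≤ γ) (X : Inst k d l) : nearOpt γ X ⊆ nearOpt μ X := by
  intro z hz
  have h1 : 0 ≤ density k d * numVar k l := by unfold density numVar; positivity
  have h2 := mul_le_mul_of_nonneg_right h h1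
  simp only [nearOpt, Set.mem_ofPred_eq, mul_assoc] at hz ⊢
  linarith

/-- A stable and near-optimal algorithm makes some tuple of replicas overlap with constant
probability. -/
lemma pow_le_of_isStable_of_isOptimal (P : Measure Ω) [IsProbabilityMeasure P] (A : QAlg k d l Ω)
    {f : ℕ} {L : ℝ≥0} {pst γ pf μ : ℝ} (hst : IsStable P A f L pst) (hopt : IsOptimal P A γ pf)
    (hγ : μ ≤ γ) {W s τ : ℝ} (hs : 0 < s) (hτ0 : 0 ≤ τ) (hτ : W ^ 2 ≤ τ * s ^ 2) (Q : ℕ)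
    (hm : 0 < d * l) (κ : ℕ → ℝ) (hκ0 : κ 0 = 0) (hκmono : Monotone κ) (hκ1 : κ Q ≤ 1)
    (hW : ∀ t < Q, L * ((⌊κ (t + 1) * ((d * l : ℕ) : ℝ)⌋₊ - ⌊κ t * ((d * l : ℕ) : ℝ)⌋₊ : ℕ) : ℝ)
      < W)
    {c₀ : ℝ} (hc₀ : 0 ≤ c₀) (hc : (Q + 1) * pf + Q * pst + Q * τ + c₀ ≤ 1)
    {R T : ℕ} (hR : 0 < R) {ι : Type} [Fintype ι] (tm : ι → ℕ)
    (S : ι → Set (Fin R → Inst k d l)) {ε : ℝ}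
    (hε : ∀ c, ((corrLaw k d l R (κ (tm c))).toOuterMeasure (S c)).toReal ≤ ε)
    (hE : ∀ X : Fin T → ℕ → Inst k d l,
      (∃ z, ∀ r, HasPath (Near f s) Q (fun t => nearOpt μ (X r t)) z) →
      ∃ c, ∃ e : Fin R ↪ Fin T, (fun r => X (e r) (tm c)) ∈ S c) :
    c₀ ^ T ≤ Fintype.card ι * Nat.card (Fin R ↪ Fin T) * ε := by
  classical
  have hmR : (0 : ℝ) < ((d * l : ℕ) : ℝ) := by exact_mod_cast hm
  set p : ℕ → ℕ := fun t => ⌊κ t * ((d * l : ℕ) : ℝ)⌋₊ with hp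
  have hpmono : ∀ t, p t ≤ p (t + 1) := fun t =>
    Nat.floor_mono (mul_le_mul_of_nonneg_right (hκmono (Nat.le_succ t)) hmR.le)
  have hple : ∀ t ≤ Q, p t ≤ d * l := by
    intro t ht
    refine Nat.floor_le_of_le ?_
    have := mul_le_mul_of_nonneg_right ((hκmono ht).trans hκ1) hmR.le
    linarith
  -- The increment is defined through the rounded positions, so that its own floor is exactly the
  -- number of clauses replaced in step `t`.
  set κ' : ℕ → ℝ := fun t => ((p (t + 1) - p t : ℕ) : ℝ) / ((d * l : ℕ) : ℝ) with hκ'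
  have hκ'01 : ∀ t < Q, κ' t ∈ Set.Icc (0 : ℝ) 1 := by
    intro t ht
    refine ⟨by positivity, (div_le_one hmR).2 ?_⟩
    have := hple (t + 1) ht
    exact_mod_cast (Nat.sub_le _ _).trans this
  have hκ'fl : ∀ t < Q, ⌊κ' t * ((d * l : ℕ) : ℝ)⌋₊ = p (t + 1) - p t := by
    intro t _
    rw [hκ', div_mul_cancel₀ _ hmR.ne', Nat.floor_natCast]
  obtain ⟨ω, hω⟩ := exists_sample P A hst hopt Q κ' hκ'01
  have hfail : mean (instLaw k d l) (fun X => failProb (A.state X ω) (nearOpt μ X))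
      ≤ mean (instLaw k d l) (fun X => failProb (A.state X ω) (nearOpt γ X)) :=
    mean_mono _ fun X => failProb_mono _ (nearOpt_anti hγ X)
  have hb := (add_le_add (mul_le_mul_of_nonneg_left hfail (by positivity : (0 : ℝ) ≤ Q + 1))
    le_rfl).trans hω
  have key := pow_le_expect_hasPath A f ω hs hτ0 hτ Q p (by simp [hp, hκ0]) (fun t _ => hpmono t)
    hple hW κ' hκ'fl (fun X => nearOpt μ X) hb (by linarith) T
  have hpκ : ∀ c, ⌊κ (tm c) * ((d * l : ℕ) : ℝ)⌋₊ = p (tm c) := fun c => rfl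
  have hc₁ : c₀ ≤ 1 - ((Q + 1) * pf + Q * pst + Q * τ) := by linarith
  clear_value p
  have hunion := expect_le_of_forall_exists_tuple hR (fun c => p (tm c)) (fun c => κ (tm c)) hpκ
    S hε (fun G σ v w => ∃ z, ∀ r, HasPath (Near f s) Q
        (fun t => nearOpt μ (conMat G, resample σ (p t) v (w r))) z)
    fun G σ v w hGw => hE (fun r t => (conMat G, resample σ (p t) v (w r))) hGw
  refine (pow_le_pow_left₀ hc₀ hc₁ T).trans (key.trans (le_trans (le_of_eq ?_) hunion))
  exact Finset.expect_congr rfl fun G _ => Finset.expect_congr rfl fun σ _ =>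
    Finset.expect_congr rfl fun v _ => Finset.expect_congr rfl fun w _ => by congr!

lemma minHamming_le_of_near {f : ℕ} {s : ℝ} {a b a' b' : Bits (Var k l)} (ha : Near f s a a')
    (hb : Near f s b b') : (minHamming a' b' : ℝ) ≤ minHamming a b + 2 * (f + s) := by
  have h : (minHamming a' b' : ℝ) ≤ minHamming a b + (hammingDist a' a + hammingDist b' b) := by
    exact_mod_cast minHamming_le_add a' b' a b
  rw [hammingDist_comm a' a, hammingDist_comm b' b] at h
  unfold Near at ha hb
  linarith

/-- Among many chains with a common start, `R` of them overlap simultaneously. -/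
lemma exists_overlap_of_hasPath {R Q T f : ℕ} {μ ν₁ ν₂ s : ℝ}
    (hT : ∀ col : Fin T → Fin T → Option (Fin (Q + 1)), ∃ ι : Fin R → Fin T,
      Function.Injective ι ∧ ∃ c, ∀ i j, i < j → col (ι i) (ι j) = c)
    (hν1 : 0 ≤ ν₁) (hν : ν₁ ≤ ν₂) (hs : 2 * (f + s) = (ν₂ - ν₁) * numVar k l)
    (X : Fin T → ℕ → Inst k d l)
    (h : ∃ z, ∀ r, HasPath (Near f s) Q (fun t => nearOpt μ (X r t)) z) :
    ∃ c : Option (Fin (Q + 1)), ∃ e : Fin R ↪ Fin T,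
      (fun r => X (e r) (c.elim Q Fin.val)) ∈
        {Y | (overlapSet Y μ (c.elim 0 fun _ => ν₁) ν₂).Nonempty} := by
  have hn : 0 ≤ numVar k l := Nat.cast_nonneg _
  obtain ⟨z, hz⟩ := h
  choose x hx0 hxO hxN using hz
  set rel : Option (Fin (Q + 1)) → Fin T → Fin T → Prop := fun c a b =>
    (minHamming (x a (c.elim Q Fin.val)) (x b (c.elim Q Fin.val)) : ℝ) ∈
      Set.Icc ((c.elim 0 fun _ => ν₁) * numVar k l) (ν₂ * numVar k l) with hrel
  -- Colour `some t` records that the pair is in the window at time `t`, and `none` that its final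
  -- distance is at most `ν₂ n`. If the window is always missed, the distance stays below `ν₁ n`,
  -- since one step adds at most `(ν₂ - ν₁) n`, and then `none` applies.
  have hcol : ∀ a b, ∃ c, rel c a b := by
    intro a b
    by_contra! hno
    have hall : ∀ t ≤ Q, (minHamming (x a t) (x b t) : ℝ) ≤ ν₂ * numVar k l := by
      intro t
      induction t with
      | zero =>
        intro _
        rw [hx0, hx0, minHamming_self]
        push_cast
        exact mul_nonneg (hν1.trans hν) hn
      | succ t ih =>
        intro ht
        have h1 := ih (by omega)
        have h2 := hno (some ⟨t, by omega⟩)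
        have h3 : (minHamming (x a t) (x b t) : ℝ) < ν₁ * numVar k l := by
          by_contra! h4
          exact h2 ⟨h4, h1⟩
        have h4 := minHamming_le_of_near (hxN a t ht) (hxN b t ht)
        rw [hs] at h4
        linarith
    refine hno none ⟨?_, hall Q le_rfl⟩
    simp
  choose col hcol using hcol
  obtain ⟨ι, hι, c, hc⟩ := hT col
  refine ⟨c, ⟨ι, hι⟩, fun r => x (ι r) (c.elim Q Fin.val), fun r => ?_, fun r r' hr => ?_⟩
  · refine hxO (ι r) _ ?_
    cases c with
    | none => exact le_rfl
    | some t => exact Nat.le_of_lt_succ t.2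
  · rcases lt_or_gt_of_ne hr with h1 | h1
    · have := hcol (ι r) (ι r')
      rwa [hc r r' h1] at this
    · have := hcol (ι r') (ι r)
      rw [hc r' r h1] at this
      rw [minHamming_comm]
      exact this

/-- As `y ≤ 1`, the hypothesis gives `f + a √q < N / 4`. Doubling it leaves `2 a √q` below `N / 2 -
f`. -/
lemma step_lt_of_lt {a q y f N : ℝ} (ha : 0 ≤ a) (hq : 0 < q) (hy0 : 0 < y) (hy1 : y ≤ 1)
    (hf : 0 ≤ f) (h : f + a * Real.sqrt (q / y) < N / 4) :
    0 < N / 2 - f ∧ 2 * a < (N / 2 - f) / Real.sqrt q := by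
  have h1 : Real.sqrt q ≤ Real.sqrt (q / y) := by
    refine Real.sqrt_le_sqrt ?_
    rw [le_div_iff₀ hy0]
    nlinarith
  have hq' : 0 < Real.sqrt q := Real.sqrt_pos.2 hq
  have h2 := mul_le_mul_of_nonneg_left h1 ha
  have h3 := mul_nonneg ha hq'.le
  refine ⟨by linarith, ?_⟩
  rw [lt_div_iff₀ hq']
  linarith

/-- Rounding adds at most one clause to a step of `m / Q ≥ 1` clauses, hence the factor `2`. -/
lemma floor_step_le {m Q t : ℕ} (hQ : 1 ≤ Q) (hm : Q ≤ m) :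
    ((⌊((t + 1 : ℕ) : ℝ) / Q * m⌋₊ - ⌊(t : ℝ) / Q * m⌋₊ : ℕ) : ℝ) ≤ 2 * (m / Q) := by
  have hQ' : (0 : ℝ) < Q := by exact_mod_cast hQ
  have h1 : (1 : ℝ) ≤ m / Q := (one_le_div hQ').2 (by exact_mod_cast hm)
  have h2 : (⌊((t + 1 : ℕ) : ℝ) / Q * m⌋₊ : ℝ) ≤ ((t + 1 : ℕ) : ℝ) / Q * m :=
    Nat.floor_le (by positivity)
  have h3 := Nat.lt_floor_add_one ((t : ℝ) / Q * m)
  have h4 : ((t + 1 : ℕ) : ℝ) / Q * m = (t : ℝ) / Q * m + m / Q := by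
    push_cast
    ring
  rcases le_total ⌊((t + 1 : ℕ) : ℝ) / Q * m⌋₊ ⌊(t : ℝ) / Q * m⌋₊ with h | h
  · rw [Nat.sub_eq_zero_of_le h]
    push_cast
    linarith
  · rw [Nat.cast_sub h]
    linarith

lemma pst_nonneg {P : Measure Ω} {A : QAlg k d l Ω} {f : ℕ} {L : ℝ≥0} {pst : ℝ}
    (h : IsStable P A f L pst) : 0 ≤ pst :=
  le_trans (Finset.sum_nonneg fun _ _ => mul_nonneg ENNReal.toReal_nonneg measureReal_nonneg)
    (h 0 ⟨le_rfl, zero_le_one⟩)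

end Obstruction

-- The two obstructions

universe v

theorem not_stable_and_optimal_of_rogp (R Q : ℕ) (hR : 2 ≤ R) (hQ : 1 ≤ Q) :
    ∃ δ : ℝ, 0 < δ ∧
      ∀ (k d : ℕ) (μ ν₁ ν₂ : ℝ), 1 ≤ k → 1 ≤ d → 0 ≤ ν₁ → ν₁ < ν₂ →
        HasROGP k d R μ ν₁ ν₂ →
        ∀ᶠ l : ℕ in Filter.atTop, ∀ (f : ℕ) (L : NNReal) (pst γ pf : ℝ),
          pst + pf ≤ δ → μ ≤ γ →
          (f : ℝ) / numVar k l + density k d * L / Q *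
            Real.sqrt ((Q + 1) / (1 - (Q + 1) * Real.sqrt (3 * pf))) < (ν₂ - ν₁) / 4 →
          ∀ (Ω : Type v) [MeasurableSpace Ω] (P : MeasureTheory.Measure Ω)
            [MeasureTheory.IsProbabilityMeasure P] (A : QAlg k d l Ω),
            ¬ (IsStable P A f L pst ∧ IsOptimal P A γ pf) := by
  have hQ0 : (0 : ℝ) < Q := by exact_mod_cast hQ
  have hQ1 : (0 : ℝ) < (Q : ℝ) + 1 := by positivity
  -- With `τ = 1 / (Q + 1)` the coupling losses sum to `1 - 1 / (Q + 1)`. This `δ` limits the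
  -- remaining failures to a quarter of `1 / (Q + 1)`, which leaves room for `c₀`, a half of it.
  refine ⟨1 / (4 * ((Q : ℝ) + 1) ^ 2), by positivity, ?_⟩
  intro k d μ ν₁ ν₂ hk hd hν1 hν hogp
  obtain ⟨T, hT⟩ := exists_ramsey (Option (Fin (Q + 1))) R
  set c₀ : ℝ := 1 / (2 * ((Q : ℝ) + 1)) with hc₀
  have hc₀pos : 0 < c₀ := by positivity
  -- `M` counts the terms of the union bound: colours times embeddings of the `R` chosen replicas.
  set M : ℝ := Fintype.card (Option (Fin (Q + 1))) * Nat.card (Fin R ↪ Fin T) with hM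
  have hM0 : 0 ≤ M := by positivity
  set ε : ℝ := c₀ ^ T / (M + 1) with hε
  have hεpos : 0 < ε := by positivity
  have hMε : M * ε < c₀ ^ T := by
    rw [hε, ← mul_div_assoc, div_lt_iff₀ (by positivity)]
    nlinarith [pow_pos hc₀pos T]
  have hbound : ∀ c : Option (Fin (Q + 1)), ∀ᶠ l : ℕ in atTop,
      ((corrLaw k d l R (((c.elim Q Fin.val : ℕ) : ℝ) / Q)).toOuterMeasure
        {X | (overlapSet X μ (c.elim 0 fun _ => ν₁) ν₂).Nonempty}).toReal ≤ ε := by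
    intro c
    refine OverlapBound.eventually_le hk ?_ hεpos
    cases c with
    | none =>
      have := hogp.2 μ le_rfl
      simpa [div_self hQ0.ne'] using this
    | some t =>
      refine hogp.1 _ ⟨by positivity, (div_le_one hQ0).2 ?_⟩ μ le_rfl
      exact_mod_cast Nat.le_of_lt_succ t.2
  filter_upwards [eventually_all.2 hbound, eventually_ge_atTop Q] with l hl hlQ
  rintro f L pst γ pf hδ hγ hlt Ω _ P _ A ⟨hst, hopt⟩
  have hmQ : Q ≤ d * l := hlQ.trans (Nat.le_mul_of_pos_left l hd)
  have hn : 0 < numVar k l := by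
    unfold numVar
    exact_mod_cast Nat.mul_pos hk (hQ.trans hlQ)
  have hpst := pst_nonneg hst
  have hx : ((Q : ℝ) + 1) * Real.sqrt (3 * pf) < 1 := by
    have h1 : Real.sqrt (3 * pf) ≤ Real.sqrt (3 / (4 * ((Q : ℝ) + 1) ^ 2)) := by
      refine Real.sqrt_le_sqrt ?_
      have : 3 / (4 * ((Q : ℝ) + 1) ^ 2) = 3 * (1 / (4 * ((Q : ℝ) + 1) ^ 2)) := by ring
      linarith
    have h2 : Real.sqrt (3 / (4 * ((Q : ℝ) + 1) ^ 2)) < 1 / ((Q : ℝ) + 1) := by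
      rw [Real.sqrt_lt' (by positivity), div_pow, one_pow,
        div_lt_div_iff₀ (by positivity) (by positivity)]
      nlinarith [pow_pos hQ1 2]
    have h3 := lt_of_le_of_lt h1 h2
    rwa [lt_div_iff₀ hQ1, mul_comm] at h3
  have hx0 : 0 ≤ ((Q : ℝ) + 1) * Real.sqrt (3 * pf) := by positivity
  have hlt' : (f : ℝ) + ((d * l : ℕ) : ℝ) * L / Q *
      Real.sqrt ((Q + 1) / (1 - (Q + 1) * Real.sqrt (3 * pf)))
        < ((ν₂ - ν₁) * numVar k l) / 4 := by
    have h := mul_lt_mul_of_pos_right hlt hn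
    rw [add_mul, div_mul_cancel₀ _ hn.ne'] at h
    rw [← density_mul_numVar hk]
    calc _ = _ := by ring
      _ < _ := h
      _ = _ := by ring
  obtain ⟨hs, hstep⟩ := step_lt_of_lt (by positivity) hQ1 (by linarith) (by linarith)
    (Nat.cast_nonneg f) hlt'
  set s : ℝ := (ν₂ - ν₁) * numVar k l / 2 - f with hsdef
  have hmono : Monotone fun t : ℕ => (t : ℝ) / Q := fun a b hab =>
    div_le_div_of_nonneg_right (Nat.cast_le.2 hab) hQ0.le
  -- Here `s` is chosen so that `2 (f + s)` is the window width, and `W` so that `W ^ 2 = τ s ^ 2`.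
  have hfinal := pow_le_of_isStable_of_isOptimal (P := P) (A := A) hst hopt hγ
    (W := s / Real.sqrt (Q + 1)) (s := s) (τ := 1 / ((Q : ℝ) + 1)) hs (by positivity)
    (by rw [div_pow, Real.sq_sqrt hQ1.le]; exact le_of_eq (by ring)) Q (by omega)
    (fun t => (t : ℝ) / Q) (by simp) hmono (div_self hQ0.ne').le
    (fun t _ => lt_of_le_of_lt
      ((mul_le_mul_of_nonneg_left (floor_step_le hQ hmQ) L.coe_nonneg).trans
        (le_of_eq (by ring))) hstep)
    hc₀pos.le ?_ (by omega) (ι := Option (Fin (Q + 1))) (fun c => c.elim Q Fin.val)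
    (fun c => {X | (overlapSet X μ (c.elim 0 fun _ => ν₁) ν₂).Nonempty}) hl
    (fun X hX => exists_overlap_of_hasPath hT hν1 hν.le (by rw [hsdef]; ring) X hX)
  · exact absurd hfinal (not_le.2 hMε)
  · have h1 : (Q + 1) * pf + Q * pst ≤ 1 / (4 * ((Q : ℝ) + 1)) := by
      have h2 : (Q + 1) * (pst + pf) ≤ (Q + 1) * (1 / (4 * ((Q : ℝ) + 1) ^ 2)) :=
        mul_le_mul_of_nonneg_left hδ hQ1.le
      have h3 : ((Q : ℝ) + 1) * (1 / (4 * ((Q : ℝ) + 1) ^ 2)) = 1 / (4 * ((Q : ℝ) + 1)) := by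
        field_simp
      nlinarith
    have h4 : (Q : ℝ) * (1 / ((Q : ℝ) + 1)) + 1 / (4 * ((Q : ℝ) + 1)) + c₀ ≤ 1 := by
      rw [hc₀]
      have : (Q : ℝ) * (1 / ((Q : ℝ) + 1)) + 1 / (4 * ((Q : ℝ) + 1)) + 1 / (2 * ((Q : ℝ) + 1))
          = 1 - 1 / (4 * ((Q : ℝ) + 1)) := by
        field_simp
        ring
      rw [this]
      have : 0 ≤ 1 / (4 * ((Q : ℝ) + 1)) := by positivity
      linarith
    linarith

theorem not_stable_and_optimal_of_chaos (R k d : ℕ) (μ ν₂ : ℝ) (hR : 2 ≤ R) (hk : 1 ≤ k)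
    (hd : 1 ≤ d) (hchaos : HasChaos k d R μ ν₂) :
    ∀ᶠ l : ℕ in Filter.atTop, ∀ (f : ℕ) (L : NNReal) (pst γ pf : ℝ),
        pst + pf ≤ 1 / 12 → pf < 1 / 12 → μ ≤ γ →
        (f : ℝ) / numVar k l + density k d * L *
          Real.sqrt (2 / (1 - 2 * Real.sqrt (3 * pf))) < ν₂ / 4 →
        ∀ (Ω : Type v) [MeasurableSpace Ω] (P : MeasureTheory.Measure Ω)
          [MeasureTheory.IsProbabilityMeasure P] (A : QAlg k d l Ω),
          ¬ (IsStable P A f L pst ∧ IsOptimal P A γ pf) := by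
  set c₀ : ℝ := 1 / 2 with hc₀
  set M : ℝ := Fintype.card Unit * Nat.card (Fin R ↪ Fin R) with hM
  have hM0 : 0 ≤ M := by positivity
  set ε : ℝ := c₀ ^ R / (M + 1) with hε
  have hεpos : 0 < ε := by positivity
  have hMε : M * ε < c₀ ^ R := by
    rw [hε, ← mul_div_assoc, div_lt_iff₀ (by positivity)]
    nlinarith [pow_pos (by norm_num : (0 : ℝ) < 1 / 2) R]
  filter_upwards [OverlapBound.eventually_le hk (hchaos μ le_rfl) hεpos, eventually_ge_atTop 1]
    with l hl hl1
  rintro f L pst γ pf hδ hpf hγ hlt Ω _ P _ A ⟨hst, hopt⟩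
  have hm : 0 < d * l := Nat.mul_pos hd hl1
  have hn : 0 < numVar k l := by
    unfold numVar
    exact_mod_cast Nat.mul_pos hk hl1
  have hx : Real.sqrt (3 * pf) < 1 / 2 := by
    rw [Real.sqrt_lt' (by norm_num)]
    linarith
  have hx0 : 0 ≤ Real.sqrt (3 * pf) := Real.sqrt_nonneg _
  have hlt' : (f : ℝ) + ((d * l : ℕ) : ℝ) * L * Real.sqrt (2 / (1 - 2 * Real.sqrt (3 * pf)))
        < (ν₂ * numVar k l) / 4 := by
    have h := mul_lt_mul_of_pos_right hlt hn
    rw [add_mul, div_mul_cancel₀ _ hn.ne'] at h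
    rw [← density_mul_numVar hk]
    calc _ = _ := by ring
      _ < _ := h
      _ = _ := by ring
  obtain ⟨hs, hstep⟩ := step_lt_of_lt (by positivity) two_pos (by linarith) (by linarith)
    (Nat.cast_nonneg f) hlt'
  set s : ℝ := ν₂ * numVar k l / 2 - f with hsdef
  -- A single step from `κ = 0` to `κ = 1` with `T = R` replicas: all endpoints are within `f + s`
  -- of the common start, hence pairwise within `ν₂ n`. There is no rounding, so the spare factor
  -- `2` of `hstep` goes into `W`, giving `τ = 1 / 8`.
  have hfinal := pow_le_of_isStable_of_isOptimal (P := P) (A := A) hst hopt hγ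
    (W := s / Real.sqrt 2 / 2) (s := s) (τ := 1 / 8) hs (by norm_num)
    (by rw [div_pow, div_pow, Real.sq_sqrt two_pos.le]; exact le_of_eq (by ring)) 1 hm
    (fun t => (t : ℝ)) (by simp) Nat.mono_cast (by simp)
    (fun t ht => ?_) (c₀ := c₀) (by positivity) ?_ (T := R) (by omega) (ι := Unit) (fun _ => 1)
    (fun _ => {X | (overlapSet X μ 0 ν₂).Nonempty}) (ε := ε) (fun _ => by simpa using hl)
    (fun X hX => ⟨(), Function.Embedding.refl _, ?_⟩)
  · exact absurd hfinal (not_le.2 hMε)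
  · obtain rfl : t = 0 := by omega
    simp only [zero_add, Nat.cast_one, one_mul, Nat.floor_natCast, Nat.cast_zero, zero_mul,
      Nat.floor_zero, Nat.sub_zero]
    linarith
  · push_cast
    linarith
  · obtain ⟨z, hz⟩ := hX
    choose x hx0 hxO hxN using hz
    refine ⟨fun r => x r 1, fun r => hxO r 1 le_rfl, fun r r' _ => ⟨by simp, ?_⟩⟩
    have h := minHamming_le_of_near (hxN r 0 zero_lt_one) (hxN r' 0 zero_lt_one)
    rw [hx0, hx0, minHamming_self] at h
    refine h.trans (le_of_eq ?_)
    rw [hsdef]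
    push_cast
    ring

end StableXor

end

theorem mainTheorem2 :
    (∀ R Q : ℕ, 2 ≤ R → 1 ≤ Q → ∃ δ : ℝ, 0 < δ ∧
      ∀ (k d : ℕ) (μ ν₁ ν₂ : ℝ), 1 ≤ k → 1 ≤ d → 0 ≤ ν₁ → ν₁ < ν₂ → ν₂ < 1 / 2 →
        HasROGP k d R μ ν₁ ν₂ →
        ∀ᶠ l : ℕ in Filter.atTop, ∀ (f : ℕ) (L : NNReal) (pst γ pf : ℝ),
          pst + pf ≤ δ → μ ≤ γ →
          (f : ℝ) / numVar k l + density k d * L / Q *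
            Real.sqrt ((Q + 1) / (1 - (Q + 1) * Real.sqrt (3 * pf))) < (ν₂ - ν₁) / 4 →
          ∀ (Ω : Type u) [MeasurableSpace Ω] (P : MeasureTheory.Measure Ω)
            [MeasureTheory.IsProbabilityMeasure P] (A : QAlg k d l Ω),
            ¬ (IsStable P A f L pst ∧ IsOptimal P A γ pf)) ∧
    (∀ (R k d : ℕ) (μ ν₂ : ℝ), 2 ≤ R → 1 ≤ k → 1 ≤ d → 0 < ν₂ → ν₂ < 1 / 2 →
      HasChaos k d R μ ν₂ →
      ∀ᶠ l : ℕ in Filter.atTop, ∀ (f : ℕ) (L : NNReal) (pst γ pf : ℝ),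
        pst + pf ≤ 1 / 12 → pf < 1 / 12 → μ ≤ γ →
        (f : ℝ) / numVar k l + density k d * L *
          Real.sqrt (2 / (1 - 2 * Real.sqrt (3 * pf))) < ν₂ / 4 →
        ∀ (Ω : Type u) [MeasurableSpace Ω] (P : MeasureTheory.Measure Ω)
          [MeasureTheory.IsProbabilityMeasure P] (A : QAlg k d l Ω),
          ¬ (IsStable P A f L pst ∧ IsOptimal P A γ pf)) := by
  refine ⟨fun R Q hR hQ => ?_, fun R k d μ ν₂ hR hk hd _ _ h =>
    not_stable_and_optimal_of_chaos R k d μ ν₂ hR hk hd h⟩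
  obtain ⟨δ, hδ, h⟩ := not_stable_and_optimal_of_rogp R Q hR hQ
  exact ⟨δ, hδ, fun k d μ ν₁ ν₂ hk hd h0 h1 _ hogp => h k d μ ν₁ ν₂ hk hd h0 h1 hogp⟩
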